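/- Let $n\ge 1$, let $\mathcal S^n\subset\mathbb R^{n+1}$ be the unit sphere with its rotation invariant surface measure $\sigma$ and geodesic distance $\angle(x,y)=\arccos\langle x,y\rangle$, and equip $\mathbb H=\mathbb R_+\times\mathcal S^n$ with the measure $d\sigma(x)\,\frac{da}{a}$. Let $\Pi:\mathbb H\times\mathbb H\to\mathbb C$ be a reproducing kernel on $L^2(\mathbb H)$: every section $\Pi(p,\cdot)$ is in $L^2(\mathbb H)$, $\Pi(q,p)=\overline{\Pi(p,q)}$, and $\int_{\mathbb H}\Pi(p,q)\Pi(q,r)\,dq=\Pi(p,r)$; let $\mathcal U=\{s\in L^2(\mathbb H):\ s(p)=\int_{\mathbb H}\Pi(p,q)s(q)\,dq \text{ for a.e. }p\}$ be its reproducing kernel space. For a measure $\mu$ on $\mathbb H$ we say that the kernel functions $\Pi(p,\cdot)$ are a frame for $\mathcal U$ with weight $\mu$ if for some $0\le\eta<1$ and all $s\in\mathcal U$ the function $p\mapsto\int_{\mathbb H}\Pi(p,q)s(q)\,dq$ is ($\mu$-almost everywhere) measurable and $$(1-\eta)\|s\|^2\le\int_{\mathbb H}\Big|\int_{\mathbb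 H}\Pi(p,q)\,s(q)\,dq\Big|^2d\mu(p)\le(1+\eta)\|s\|^2 ;$$ the index set of the family is the set on which $\mu$ is concentrated. Let $(b_j)_{j\in\mathbb N_0}$ be positive scales with $\tilde\delta\le b_j/b_{j+1}\le\delta$ for all $j$ and some $\tilde\delta>1$, and put $\nu_j=\log(b_j/b_{j+1})$. Suppose that for some constants $C>0$ and $0\le\Delta<1$ the functions $\Pi(b_j,x;\cdot,\cdot)$, $j\in\mathbb N_0$, $x\in\mathcal S^n$, are a frame for $\mathcal U$ with weight $\sum_j C\nu_j\,\delta_{b_j}\otimes\sigma$, with bounds $1\pm\Delta$, i.e. for all $s\in\mathcal U$ $$(1-\Delta)\|s\|^2\le C\sum_j\int_{\mathcal S^n}\Big|\int_{\mathbb H}\Pi(b_j,x;b,y)\,s(b,y)\,d\sigma(y)\frac{db}{b}\Big|^2d\sigma(x)\,\nu_j\le(1+\Delta)\|s\|^2 .$$ Suppose further that there are positive constants $\mathfrak d,\omega,\epsilon,\tilde\epsilon$ with $\tilde\epsilon<1/2$ such that for all $0<a,b\le b_0$ and all $x,y\in\mathcal S^n$ the kernel $\Pi(a,x;b,y)$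 is differentiable in $x$ and in $y$ and each of the quantities $t=|\Pi(a,x;b,y)|$, $t=(a+b)\,|\nabla_{*,x}\Pi(a,x;b,y)|$ and $t=(a+b)\,|\nabla_{*,y}\Pi(a,x;b,y)|$ (where $\nabla_*$ is the surface gradient on $\mathcal S^n$) satisfies $$t\le(ab)^{n+\epsilon}\,\frac{\mathfrak d}{(a+b)^{3n+2\epsilon}}\quad\text{if }\angle(x,y)\le\omega[a+(2-\tilde\epsilon)b],\qquad t\le(ab)^{n+\epsilon}\,\frac{\mathfrak d}{\angle(x,y)^{3n+2\epsilon}}\quad\text{if }\angle(x,y)>\omega(a+\tilde\epsilon b).$$ A grid of type $(\delta,\Xi)$ on the scales $(b_j)$ consists, for every $j$, of a finite measurable partition of $\mathcal S^n$ into simply connected sets $\mathcal O_{j,k}$ of geodesic diameter at most $\Xi b_j$ and of exactly one point $(b_j,y_{j,k})$ with $y_{j,k}\in\mathcal O_{j,k}$ for each of these sets. Then there are constants $\rho>0$ and $C'>0$ such that for every grid of type $(\delta,\Xi)$ on $(b_j)$ with $\Xi\le\rho$ the family $\{\Pi(b_j,y_{j,k};\cdot,\cdot)\}_{j,k}$ is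 a frame for $\mathcal U$ with weight $$\sum_{j,k}C\,\nu_j\,\sigma(\mathcal O_{j,k})\,\delta_{(b_j,y_{j,k})},$$ and it is also a frame for $\mathcal U$ with weight $\sum_{j,k}C'\,\sigma(\mathcal O_{j,k})\,\delta_{(b_j,y_{j,k})}$. -/

import Mathlib

open MeasureTheory Set Metric
open scoped ENNReal InnerProductSpace ComplexConjugate

noncomputable section

namespace SphereFrames

/-! ### Frames with a weight -/

/-- The frame inequalities with constant `ε` for the family `g`, indexed by the measure space
`(X, μ)`, in the Hilbert space `E`, together with weak measurability of the family.
The index set of the family is the set on which `μ` is concentrated: measurability is only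
required up to `μ`-null sets. -/
def IsFrameWith {X : Type*} [MeasurableSpace X] {E : Type*} [NormedAddCommGroup E]
    [InnerProductSpace ℂ E] (g : X → E) (μ : Measure X) (ε : ℝ) : Prop :=
  ∀ u : E, AEMeasurable (fun x => ⟪g x, u⟫_ℂ) μ ∧
    ENNReal.ofReal ((1 - ε) * ‖u‖ ^ 2) ≤ ∫⁻ x, ‖⟪g x, u⟫_ℂ‖ₑ ^ 2 ∂μ ∧
    ∫⁻ x, ‖⟪g x, u⟫_ℂ‖ₑ ^ 2 ∂μ ≤ ENNReal.ofReal ((1 + ε) * ‖u‖ ^ 2)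

/-- The family `g` is a frame with weight `μ`: the frame inequalities hold for some
`0 ≤ ε < 1`. -/
def IsWeightedFrame {X : Type*} [MeasurableSpace X] {E : Type*} [NormedAddCommGroup E]
    [InnerProductSpace ℂ E] (g : X → E) (μ : Measure X) : Prop :=
  ∃ ε : ℝ, 0 ≤ ε ∧ ε < 1 ∧ IsFrameWith g μ ε

/-! ### Reproducing kernel subspaces of `L²` -/

/-- `κ` is the reproducing kernel of a subspace of `L²(X, μ)`: its sections are square integrable,
it is Hermitian, and it reproduces its own sections. -/
structure IsReproducingKernel {X : Type*} [MeasurableSpace X] (μ : Measure X)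
    (κ : X → X → ℂ) : Prop where
  memLp : ∀ p, MemLp (κ p) 2 μ
  hermitian : ∀ p q, κ q p = conj (κ p q)
  reproduces : ∀ p r, ∫ q, κ p q * κ q r ∂μ = κ p r

section Kernel

variable {X : Type*} [MeasurableSpace X] {μ : Measure X} {κ : X → X → ℂ}

theorem IsReproducingKernel.integrable_mul (h : IsReproducingKernel μ κ) (p : X)
    {u : X → ℂ} (hu : MemLp u 2 μ) : Integrable (fun q => κ p q * u q) μ :=
  (h.memLp p).integrable_mul hu

/-- The reproducing kernel space of `κ`: all `u ∈ L²(X, μ)` with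
`u(p) = ∫ κ(p, q) u(q) dμ(q)` for almost every `p`. -/
def kernelSpace (h : IsReproducingKernel μ κ) : Submodule ℂ (Lp ℂ 2 μ) where
  carrier := {u | ∀ᵐ p ∂μ, ∫ q, κ p q * u q ∂μ = u p}
  zero_mem' := by
    filter_upwards [Lp.coeFn_zero ℂ 2 μ] with p hp
    rw [hp]
    have : ∀ᵐ q ∂μ, κ p q * (0 : Lp ℂ 2 μ) q = 0 := by
      filter_upwards [Lp.coeFn_zero ℂ 2 μ] with q hq
      rw [hq, Pi.zero_apply, mul_zero]
    rw [integral_eq_zero_of_ae this, Pi.zero_apply]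
  add_mem' := by
    intro u v hu hv
    change ∀ᵐ p ∂μ, _
    filter_upwards [Lp.coeFn_add u v, hu, hv] with p hp hup hvp
    have : ∀ᵐ q ∂μ, κ p q * (u + v : Lp ℂ 2 μ) q = κ p q * u q + κ p q * v q := by
      filter_upwards [Lp.coeFn_add u v] with q hq
      rw [hq, Pi.add_apply, mul_add]
    rw [integral_congr_ae this,
      integral_add (h.integrable_mul p (Lp.memLp u)) (h.integrable_mul p (Lp.memLp v)),
      hup, hvp, hp, Pi.add_apply]
  smul_mem' := by
    intro c u hu
    change ∀ᵐ p ∂μ, _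
    filter_upwards [Lp.coeFn_smul c u, hu] with p hp hup
    have : ∀ᵐ q ∂μ, κ p q * (c • u : Lp ℂ 2 μ) q = c * (κ p q * u q) := by
      filter_upwards [Lp.coeFn_smul c u] with q hq
      rw [hq, Pi.smul_apply, smul_eq_mul]
      ring
    rw [integral_congr_ae this, integral_const_mul, hup, hp, Pi.smul_apply, smul_eq_mul]

theorem IsReproducingKernel.memLp_swap (h : IsReproducingKernel μ κ) (p : X) :
    MemLp (fun q => κ q p) 2 μ := by
  have : (fun q => κ q p) = fun q => conj (κ p q) := funext fun q => h.hermitian p q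
  rw [this]
  exact (h.memLp p).star

/-- The kernel function at the point `p`, as an element of the reproducing kernel space.
It is `q ↦ κ(q, p) = conj κ(p, q)`, so that its inner product with `u` (conjugate-linear in the
first entry) is `∫ κ(p, q) u(q) dμ(q)`; see `inner_kernelVector`. -/
def kernelVector (h : IsReproducingKernel μ κ) (p : X) : kernelSpace h :=
  ⟨(h.memLp_swap p).toLp _, by
    change ∀ᵐ r ∂μ, _
    filter_upwards [(h.memLp_swap p).coeFn_toLp] with r hr
    rw [hr, ← h.reproduces r p]
    refine integral_congr_ae ?_
    filter_upwards [(h.memLp_swap p).coeFn_toLp] with q hq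
    rw [hq]⟩

theorem inner_kernelVector (h : IsReproducingKernel μ κ) (p : X) (u : kernelSpace h) :
    ⟪kernelVector h p, u⟫_ℂ = ∫ q, κ p q * (u : Lp ℂ 2 μ) q ∂μ := by
  rw [Submodule.coe_inner, L2.inner_def]
  refine integral_congr_ae ?_
  filter_upwards [(h.memLp_swap p).coeFn_toLp] with q hq
  have h1 : ((kernelVector h p : kernelSpace h) : Lp ℂ 2 μ) q = κ q p := hq
  rw [RCLike.inner_apply, h1, h.hermitian p q, Complex.conj_conj, mul_comm]

end Kernel

/-! ### The sphere and the parameter space -/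

/-- The unit sphere `𝒮ⁿ` in `ℝⁿ⁺¹`. -/
abbrev Sphere (n : ℕ) : Type := sphere (0 : EuclideanSpace ℝ (Fin (n + 1))) 1

/-- The rotation invariant surface measure `σ` of `𝒮ⁿ` (not normalized to be a probability). -/
def surfaceMeasure (n : ℕ) : Measure (Sphere n) :=
  (volume : Measure (EuclideanSpace ℝ (Fin (n + 1)))).toSphere

/-- Geodesic distance on `𝒮ⁿ`. -/
def geodist {n : ℕ} (x y : Sphere n) : ℝ :=
  Real.arccos ⟪(x : EuclideanSpace ℝ (Fin (n + 1))), (y : EuclideanSpace ℝ (Fin (n + 1)))⟫_ℝ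

/-- The scales `ℝ₊`. -/
abbrev Scale : Type := Ioi (0 : ℝ)

/-- The measure `da / a` on `ℝ₊`. -/
def scaleMeasure : Measure Scale :=
  (Measure.comap (Subtype.val : Scale → ℝ) volume).withDensity
    fun a => ENNReal.ofReal (1 / (a : ℝ))

/-- The parameter space `ℝ₊ × 𝒮ⁿ`. -/
abbrev Param (n : ℕ) : Type := Scale × Sphere n

/-- The measure `dσ(x) da / a` on the parameter space. -/
def paramMeasure (n : ℕ) : Measure (Param n) := scaleMeasure.prod (surfaceMeasure n)

/-! ### Surface gradient -/

/-- The extension of a function on `𝒮ⁿ` to `ℝⁿ⁺¹ ∖ {0}` that is homogeneous of degree `0`: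
`v ↦ f (v / ‖v‖)` (and the irrelevant value `0` at the origin). -/
def radialExt {n : ℕ} (f : Sphere n → ℂ) (v : EuclideanSpace ℝ (Fin (n + 1))) : ℂ :=
  open Classical in
  if h : v = 0 then 0
  else f ⟨‖v‖⁻¹ • v, by
    rw [mem_sphere_zero_iff_norm, norm_smul, norm_inv, norm_norm,
      inv_mul_cancel₀ (norm_ne_zero_iff.mpr h)]⟩

/-- Differentiability of a function on the sphere at the point `x`. -/
def SphereDifferentiableAt {n : ℕ} (f : Sphere n → ℂ) (x : Sphere n) : Prop :=
  DifferentiableAt ℝ (radialExt f) (x : EuclideanSpace ℝ (Fin (n + 1)))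

/-- The surface gradient `∇_* f (x)`: the Euclidean gradient at `x` of the extension of `f` that is
homogeneous of degree `0`. It is a vector in `ℂⁿ⁺¹` since `f` is complex-valued. -/
def surfaceGradient {n : ℕ} (f : Sphere n → ℂ) (x : Sphere n) :
    EuclideanSpace ℂ (Fin (n + 1)) :=
  WithLp.toLp 2 fun i =>
    fderiv ℝ (radialExt f) (x : EuclideanSpace ℝ (Fin (n + 1))) (EuclideanSpace.single i 1)

/-! ### Localization -/

/-- The two-regime bound for a quantity `t ≥ 0` attached to scales `a`, `b` and the angle `θ`.
On the overlap of the two ranges of `θ` both bounds are required. -/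
def TwoRegimeBound (n : ℕ) (d ω ε ε' : ℝ) (a b θ t : ℝ) : Prop :=
  (θ ≤ ω * (a + (2 - ε') * b) →
    t ≤ (a * b) ^ ((n : ℝ) + ε) * (d / (a + b) ^ (3 * (n : ℝ) + 2 * ε))) ∧
  (ω * (a + ε' * b) < θ →
    t ≤ (a * b) ^ ((n : ℝ) + ε) * (d / θ ^ (3 * (n : ℝ) + 2 * ε)))

/-- For all scales `a, b ≤ bmax` the kernel is differentiable in both spherical variables, and the
kernel and `(a + b)` times its surface gradient with respect to each of them satisfy the two-regime
bound. -/
def IsLocalized {n : ℕ} (κ : Param n → Param n → ℂ) (bmax d ω ε ε' : ℝ) : Prop :=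
  ∀ a b : Scale, (a : ℝ) ≤ bmax → (b : ℝ) ≤ bmax → ∀ x y : Sphere n,
    SphereDifferentiableAt (fun x' => κ (a, x') (b, y)) x ∧
    SphereDifferentiableAt (fun y' => κ (a, x) (b, y')) y ∧
    TwoRegimeBound n d ω ε ε' a b (geodist x y) ‖κ (a, x) (b, y)‖ ∧
    TwoRegimeBound n d ω ε ε' a b (geodist x y)
      (((a : ℝ) + b) * ‖surfaceGradient (fun x' => κ (a, x') (b, y)) x‖) ∧
    TwoRegimeBound n d ω ε ε' a b (geodist x y)
      (((a : ℝ) + b) * ‖surfaceGradient (fun y' => κ (a, x) (b, y')) y‖)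

/-! ### Scales and grids -/

/-- The ratios of consecutive scales lie in `[δ', δ]` for some `δ' > 1`. -/
def HasScaleRatios (b : ℕ → Scale) (δ : ℝ) : Prop :=
  ∃ δ' : ℝ, 1 < δ' ∧ ∀ j, δ' ≤ (b j : ℝ) / b (j + 1) ∧ (b j : ℝ) / b (j + 1) ≤ δ

/-- The scale weights `ν_j = log (b_j / b_{j+1})`. -/
def scaleWeight (b : ℕ → Scale) (j : ℕ) : ℝ := Real.log ((b j : ℝ) / b (j + 1))

/-- The weight `∑_j C ν_j δ_{b_j} ⊗ σ` of the scale-discrete family. -/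
def semiDiscreteMeasure (n : ℕ) (b : ℕ → Scale) (C : ℝ) : Measure (Param n) :=
  Measure.sum fun j =>
    ENNReal.ofReal (C * scaleWeight b j) • (Measure.dirac (b j)).prod (surfaceMeasure n)

/-- A grid of type `(δ, Ξ)` on the sequence of scales `b`: at each scale `b_j` a finite measurable
partition of `𝒮ⁿ` into simply connected cells of geodesic diameter at most `Ξ b_j`, and exactly one
grid point `(b_j, point j k)` with `point j k` in the cell `cell j k`. -/
structure Grid (n : ℕ) (b : ℕ → Scale) (δ Ξ : ℝ) where
  ratios : HasScaleRatios b δ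
  card : ℕ → ℕ
  cell : ∀ j, Fin (card j) → Set (Sphere n)
  measurableSet_cell : ∀ j k, MeasurableSet (cell j k)
  disjoint_cell : ∀ j, Pairwise fun k l => Disjoint (cell j k) (cell j l)
  iUnion_cell : ∀ j, ⋃ k, cell j k = univ
  simplyConnected_cell : ∀ j k, IsSimplyConnected (cell j k)
  diam_cell : ∀ j k, ∀ x ∈ cell j k, ∀ y ∈ cell j k, geodist x y ≤ Ξ * b j
  point : ∀ j, Fin (card j) → Sphere n
  point_mem : ∀ j k, point j k ∈ cell j k

/-- The measure `∑ w_j σ(𝒪_{jk}) δ_{(b_j, y_{jk})}`, a sum over all points of the grid, where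
`y_{jk} ∈ 𝒪_{jk}`. -/
def Grid.pointMeasure {n : ℕ} {b : ℕ → Scale} {δ Ξ : ℝ} (G : Grid n b δ Ξ) (w : ℕ → ℝ) :
    Measure (Param n) :=
  Measure.sum fun i : (Σ j, Fin (G.card j)) =>
    (ENNReal.ofReal (w i.1) * surfaceMeasure n (G.cell i.1 i.2)) •
      Measure.dirac (b i.1, G.point i.1 i.2)

end SphereFrames

end

namespace SphereFrames

/-! ### The Schur test -/

/-! The grid family is a small perturbation of the scale-discrete frame. Both live over `ℕ × 𝒮ⁿ`
with the measure `∑ C ν_j δ_j ⊗ σ`: replacing each point by the grid point of its cell turns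
integrals over this space into sums over the grid (`Grid.lintegral_pointMeasure`). By Minkowski's
inequality (`IsFrameWith.perturb`) it suffices that the two analysis maps differ by a small multiple
of `‖s‖` in `L²`.

The kernel is controlled only at scales up to `b 0`, so `s` is not expanded over all of the
parameter space. It is synthesized from the scale-discrete frame itself, by inverting the frame
operator (`IsFrameWith.exists_coefficients`). The reproducing property then writes the difference as
an integral operator on the levels, with kernel `κ(p', q) - κ(p, q)`, where `p'` is the grid point
near `p`. The gradient bounds and the mean value inequality (`IsLocalized.norm_sub_le`) give `ρ`
times a model kernel `(ab)^(n+ε) (a + b + dist)^(-(3n+2ε))`. Its integral over the sphere is of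
order `(ab/(a+b)²)^(n+ε)`, which decays geometrically in the difference of levels
(`lintegral_levelKernel_le`), so the Schur test bounds the operator norm by a constant times `ρ`.

The second weight follows because the `ν_j` lie between two positive constants. -/

theorem sq_lintegral_mul_le {Y : Type*} [MeasurableSpace Y] {μ : Measure Y} {k f : Y → ℝ≥0∞}
    (hk : AEMeasurable k μ) (hf : AEMeasurable f μ) :
    (∫⁻ y, k y * f y ∂μ) ^ 2 ≤ (∫⁻ y, k y ∂μ) * ∫⁻ y, k y * f y ^ 2 ∂μ := by
  have hsq : ∀ x : ℝ≥0∞, (x ^ (1 / 2 : ℝ)) ^ (2 : ℝ) = x := fun x => by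
    rw [← ENNReal.rpow_mul]; norm_num
  have hmul : ∀ x : ℝ≥0∞, x ^ (1 / 2 : ℝ) * x ^ (1 / 2 : ℝ) = x := fun x => by
    rw [← sq, ← ENNReal.rpow_two, hsq]
  -- Cauchy–Schwarz for the splitting `k f = k^(1/2) · (k^(1/2) f)`.
  have h := ENNReal.lintegral_mul_le_Lp_mul_Lq μ Real.HolderConjugate.two_two
    (hk.pow_const (1 / 2 : ℝ)) ((hk.pow_const (1 / 2 : ℝ)).mul hf)
  simp only [Pi.mul_apply, ← mul_assoc, hmul,
    ENNReal.mul_rpow_of_nonneg _ _ (zero_le_two (α := ℝ)), hsq] at h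
  simp only [ENNReal.rpow_two] at h
  calc (∫⁻ y, k y * f y ∂μ) ^ 2
      ≤ ((∫⁻ y, k y ∂μ) ^ (1 / 2 : ℝ) * (∫⁻ y, k y * f y ^ 2 ∂μ) ^ (1 / 2 : ℝ)) ^ 2 := by
        gcongr
    _ = _ := by rw [← ENNReal.rpow_two, ENNReal.mul_rpow_of_nonneg _ _ (by norm_num), hsq, hsq]

/-- Cauchy–Schwarz in the inner integral costs one factor `B`; Tonelli and symmetry turn the row
bound into a column bound, which costs the other. -/
theorem schur_test {Y : Type*} [MeasurableSpace Y] {μ : Measure Y} [SFinite μ]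
    {K : Y → Y → ℝ≥0∞} (hK : Measurable (Function.uncurry K)) (hsymm : ∀ p q, K p q = K q p)
    {B : ℝ≥0∞} (hB : ∀ p, ∫⁻ q, K p q ∂μ ≤ B) {f : Y → ℝ≥0∞} (hf : AEMeasurable f μ) :
    ∫⁻ p, (∫⁻ q, K p q * f q ∂μ) ^ 2 ∂μ ≤ B ^ 2 * ∫⁻ q, f q ^ 2 ∂μ := by
  have hKp : ∀ p, Measurable (K p) := fun p => hK.of_uncurry_left
  have hf2 : AEMeasurable (fun q => f q ^ 2) μ := hf.pow_const 2
  calc ∫⁻ p, (∫⁻ q, K p q * f q ∂μ) ^ 2 ∂μ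
      ≤ ∫⁻ p, B * ∫⁻ q, K p q * f q ^ 2 ∂μ ∂μ := by
        refine lintegral_mono fun p => ?_
        refine (sq_lintegral_mul_le (hKp p).aemeasurable hf).trans ?_
        gcongr
        exact hB p
    _ ≤ B * ∫⁻ p, ∫⁻ q, K p q * f q ^ 2 ∂μ ∂μ := by
        rw [lintegral_const_mul'']
        refine AEMeasurable.lintegral_prod_right' (f := fun z : Y × Y => K z.1 z.2 * f z.2 ^ 2) ?_
        exact hK.aemeasurable.mul (hf2.comp_quasiMeasurePreserving
          Measure.quasiMeasurePreserving_snd)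
    _ = B * ∫⁻ q, ∫⁻ p, K p q * f q ^ 2 ∂μ ∂μ := by
        rw [lintegral_lintegral_swap]
        exact hK.aemeasurable.mul (hf2.comp_quasiMeasurePreserving
          Measure.quasiMeasurePreserving_snd)
    _ ≤ B * ∫⁻ q, B * f q ^ 2 ∂μ := by
        gcongr with q
        rw [lintegral_mul_const'' _ (by simp_rw [fun p => hsymm p q]; exact (hKp q).aemeasurable)]
        gcongr
        simp_rw [fun p => hsymm p q]
        exact hB q
    _ = B ^ 2 * ∫⁻ q, f q ^ 2 ∂μ := by
        rw [lintegral_const_mul'' _ hf2, sq, mul_assoc]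

/-- Each exponent occurs at most twice, once on either side of `j`; the Boolean in the injection
records the side. -/
theorem tsum_pow_natAbs_sub_le (q : ℝ≥0∞) (j : ℕ) :
    ∑' i : ℕ, q ^ ((i : ℤ) - j).natAbs ≤ 2 * (1 - q)⁻¹ := by
  have hinj : Function.Injective
      fun i : ℕ => ((((i : ℤ) - j).natAbs, decide (i < j)) : ℕ × Bool) := by
    intro i i' h
    simp only [Prod.mk.injEq, decide_eq_decide] at h
    omega
  calc ∑' i : ℕ, q ^ ((i : ℤ) - j).natAbs
      ≤ ∑' p : ℕ × Bool, q ^ p.1 :=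
        ENNReal.tsum_comp_le_tsum_of_injective hinj fun p : ℕ × Bool => q ^ p.1
    _ = 2 * (1 - q)⁻¹ := by
        rw [ENNReal.tsum_prod' (f := fun p : ℕ × Bool => q ^ p.1)]
        simp only [tsum_bool, ← two_mul]
        rw [ENNReal.tsum_mul_left, ENNReal.tsum_geometric]

/-! ### Frames and the `L²` norm -/

theorem eLpNorm_two_sq {Y : Type*} [MeasurableSpace Y] {μ : Measure Y} (h : Y → ℂ) :
    eLpNorm h 2 μ ^ 2 = ∫⁻ y, ‖h y‖ₑ ^ 2 ∂μ := by
  have := eLpNorm_nnreal_pow_eq_lintegral (μ := μ) (f := h) (p := 2) two_ne_zero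
  simpa [ENNReal.rpow_two] using this

theorem eLpNorm_two_le_ofReal_iff {Y : Type*} [MeasurableSpace Y] {μ : Measure Y} (h : Y → ℂ)
    {r : ℝ} (hr : 0 ≤ r) :
    eLpNorm h 2 μ ≤ ENNReal.ofReal r ↔ ∫⁻ y, ‖h y‖ₑ ^ 2 ∂μ ≤ ENNReal.ofReal (r ^ 2) := by
  rw [← eLpNorm_two_sq, ENNReal.ofReal_pow hr]
  exact (ENNReal.pow_le_pow_left_iff two_ne_zero).symm

theorem ofReal_le_eLpNorm_two_iff {Y : Type*} [MeasurableSpace Y] {μ : Measure Y} (h : Y → ℂ)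
    {r : ℝ} (hr : 0 ≤ r) :
    ENNReal.ofReal r ≤ eLpNorm h 2 μ ↔ ENNReal.ofReal (r ^ 2) ≤ ∫⁻ y, ‖h y‖ₑ ^ 2 ∂μ := by
  rw [← eLpNorm_two_sq, ENNReal.ofReal_pow hr]
  exact (ENNReal.pow_le_pow_left_iff two_ne_zero).symm

theorem IsFrameWith.eLpNorm_le {X : Type*} [MeasurableSpace X] {E : Type*}
    [NormedAddCommGroup E] [InnerProductSpace ℂ E] {g : X → E} {μ : Measure X} {Δ : ℝ}
    (h : IsFrameWith g μ Δ) (hΔ : 0 ≤ Δ) (u : E) :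
    eLpNorm (fun x => ⟪g x, u⟫_ℂ) 2 μ ≤ ENNReal.ofReal (√(1 + Δ) * ‖u‖) := by
  rw [eLpNorm_two_le_ofReal_iff _ (by positivity), mul_pow, Real.sq_sqrt (by positivity)]
  exact (h u).2.2

theorem IsFrameWith.le_eLpNorm {X : Type*} [MeasurableSpace X] {E : Type*}
    [NormedAddCommGroup E] [InnerProductSpace ℂ E] {g : X → E} {μ : Measure X} {Δ : ℝ}
    (h : IsFrameWith g μ Δ) (hΔ : Δ ≤ 1) (u : E) :
    ENNReal.ofReal (√(1 - Δ) * ‖u‖) ≤ eLpNorm (fun x => ⟪g x, u⟫_ℂ) 2 μ := by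
  rw [ofReal_le_eLpNorm_two_iff _ (by positivity), mul_pow, Real.sq_sqrt (by linarith)]
  exact (h u).2.1

theorem IsFrameWith.memLp {X : Type*} [MeasurableSpace X] {E : Type*}
    [NormedAddCommGroup E] [InnerProductSpace ℂ E] {g : X → E} {μ : Measure X} {Δ : ℝ}
    (h : IsFrameWith g μ Δ) (hΔ : 0 ≤ Δ) (u : E) : MemLp (fun x => ⟪g x, u⟫_ℂ) 2 μ :=
  ⟨(h u).1.aestronglyMeasurable, (h.eLpNorm_le hΔ u).trans_lt ENNReal.ofReal_lt_top⟩

/-- The analysis operator of a frame. -/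
noncomputable def IsFrameWith.analysis {X : Type*} [MeasurableSpace X] {E : Type*}
    [NormedAddCommGroup E] [InnerProductSpace ℂ E] {g : X → E} {μ : Measure X} {Δ : ℝ}
    (h : IsFrameWith g μ Δ) (hΔ : 0 ≤ Δ) : E →L[ℂ] Lp ℂ 2 μ :=
  LinearMap.mkContinuous
    { toFun := fun u => (h.memLp hΔ u).toLp _
      map_add' := fun u v => by
        rw [← MemLp.toLp_add]
        refine MemLp.toLp_congr _ _ (Filter.Eventually.of_forall fun x => ?_)
        exact inner_add_right _ _ _
      map_smul' := fun c u => by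
        rw [RingHom.id_apply, ← MemLp.toLp_const_smul]
        refine MemLp.toLp_congr _ _ (Filter.Eventually.of_forall fun x => ?_)
        exact inner_smul_right _ _ _ }
    (√(1 + Δ)) fun u => by
      change ‖(h.memLp hΔ u).toLp _‖ ≤ _
      rw [Lp.norm_toLp]
      exact ENNReal.toReal_le_of_le_ofReal (by positivity) (h.eLpNorm_le hΔ u)

theorem IsFrameWith.coeFn_analysis {X : Type*} [MeasurableSpace X] {E : Type*}
    [NormedAddCommGroup E] [InnerProductSpace ℂ E] {g : X → E} {μ : Measure X} {Δ : ℝ}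
    (h : IsFrameWith g μ Δ) (hΔ : 0 ≤ Δ) (u : E) :
    h.analysis hΔ u =ᵐ[μ] fun x => ⟪g x, u⟫_ℂ :=
  (h.memLp hΔ u).coeFn_toLp

theorem IsFrameWith.le_norm_analysis {X : Type*} [MeasurableSpace X] {E : Type*}
    [NormedAddCommGroup E] [InnerProductSpace ℂ E] {g : X → E} {μ : Measure X} {Δ : ℝ}
    (h : IsFrameWith g μ Δ) (hΔ : 0 ≤ Δ) (hΔ1 : Δ ≤ 1) (u : E) :
    √(1 - Δ) * ‖u‖ ≤ ‖h.analysis hΔ u‖ := by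
  rw [Lp.norm_def, eLpNorm_congr_ae (h.coeFn_analysis hΔ u)]
  exact (ENNReal.ofReal_le_iff_le_toReal (h.memLp hΔ u).2.ne).1 (h.le_eLpNorm hΔ1 u)

/-- Every vector is synthesized from a frame with square integrable coefficients whose norm is
controlled by the norm of the vector. -/
theorem IsFrameWith.exists_coefficients {X : Type*} [MeasurableSpace X] {E : Type*}
    [NormedAddCommGroup E] [InnerProductSpace ℂ E] [CompleteSpace E] {g : X → E}
    {μ : Measure X} {Δ : ℝ} (h : IsFrameWith g μ Δ) (hΔ : 0 ≤ Δ) (hΔ1 : Δ < 1) (s : E) :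
    ∃ f : X → ℂ, MemLp f 2 μ ∧
      ∫⁻ x, ‖f x‖ₑ ^ 2 ∂μ ≤ ENNReal.ofReal ((√(1 + Δ) / (1 - Δ) * ‖s‖) ^ 2) ∧
      ∀ u : E, ⟪u, s⟫_ℂ = ∫ x, ⟪u, g x⟫_ℂ * f x ∂μ := by
  set T := h.analysis hΔ
  set S : E →L[ℂ] E := T.adjoint ∘L T
  have hpos : 0 < 1 - Δ := by linarith
  -- The lower frame bound makes the frame operator `S = T* T` coercive, hence invertible. With `S v
  -- = s`, the coefficients are `T v`.
  have hcoer : ∀ x, ‖x‖ ^ 2 * (1 - Δ) ≤ ‖⟪S x, x⟫_ℂ‖ := fun x => by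
    have h1 : ⟪S x, x⟫_ℂ = ⟪T x, T x⟫_ℂ := T.adjoint_inner_left _ _
    rw [h1, inner_self_eq_norm_sq_to_K, norm_pow, RCLike.norm_ofReal, abs_norm]
    have h2 := pow_le_pow_left₀ (by positivity) (h.le_norm_analysis hΔ hΔ1.le x) 2
    rwa [mul_pow, Real.sq_sqrt hpos.le, mul_comm] at h2
  have hunit : IsUnit S :=
    ContinuousLinearMap.isUnit_of_forall_le_norm_inner_map S (c := ⟨1 - Δ, hpos.le⟩) hpos hcoer
  obtain ⟨v, hv⟩ : ∃ v, S v = s := by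
    obtain ⟨R, hR⟩ := hunit.exists_right_inv
    exact ⟨R s, by rw [← mul_apply_eq_comp, hR]; rfl⟩
  have hvs : ‖v‖ ≤ ‖s‖ / (1 - Δ) := by
    rw [le_div_iff₀ hpos]
    rcases (norm_nonneg v).eq_or_lt with h0 | h0
    · rw [← h0, zero_mul]; exact norm_nonneg s
    · have h1 := (hcoer v).trans (norm_inner_le_norm _ _)
      rw [hv] at h1
      nlinarith
  refine ⟨fun x => ⟪g x, v⟫_ℂ, h.memLp hΔ v, ?_, fun u => ?_⟩
  · rw [← eLpNorm_two_le_ofReal_iff _ (by positivity)]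
    refine (h.eLpNorm_le hΔ v).trans (ENNReal.ofReal_le_ofReal ?_)
    rw [div_mul_eq_mul_div, mul_div_assoc]
    gcongr
  · rw [← hv]
    change ⟪u, T.adjoint (T v)⟫_ℂ = _
    rw [T.adjoint_inner_right, L2.inner_def]
    refine integral_congr_ae ?_
    filter_upwards [h.coeFn_analysis hΔ u, h.coeFn_analysis hΔ v] with x hu hv
    rw [hu, hv, RCLike.inner_apply, inner_conj_symm, mul_comm]

/-! ### Perturbation of frames -/

/-- A family that is close in the mean to a frame is a frame. -/
theorem IsFrameWith.perturb {X : Type*} [MeasurableSpace X] {E : Type*}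
    [NormedAddCommGroup E] [InnerProductSpace ℂ E] {g g' : X → E} {μ : Measure X} {Δ Δ' η : ℝ}
    (h : IsFrameWith g μ Δ) (hΔ : 0 ≤ Δ) (hΔ1 : Δ' ≤ 1) (hΔ' : Δ ≤ Δ') (hη : 0 ≤ η)
    (hlow : √(1 - Δ') + η ≤ √(1 - Δ)) (hup : √(1 + Δ) + η ≤ √(1 + Δ'))
    (hmeas : ∀ u : E, AEMeasurable (fun x => ⟪g' x, u⟫_ℂ) μ)
    (hclose : ∀ u : E, ∫⁻ x, ‖⟪g' x - g x, u⟫_ℂ‖ₑ ^ 2 ∂μ ≤ ENNReal.ofReal ((η * ‖u‖) ^ 2)) :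
    IsFrameWith g' μ Δ' := by
  intro u
  have hd : eLpNorm (fun x => ⟪g' x - g x, u⟫_ℂ) 2 μ ≤ ENNReal.ofReal (η * ‖u‖) :=
    (eLpNorm_two_le_ofReal_iff _ (by positivity)).2 (hclose u)
  have hg := (h u).1.aestronglyMeasurable
  have hg' := (hmeas u).aestronglyMeasurable
  have hsub : (fun x => ⟪g' x - g x, u⟫_ℂ) = (fun x => ⟪g' x, u⟫_ℂ) - fun x => ⟪g x, u⟫_ℂ := by
    funext x
    exact inner_sub_left _ _ _
  have hdm : AEStronglyMeasurable (fun x => ⟪g' x - g x, u⟫_ℂ) μ := hsub ▸ hg'.sub hg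
  refine ⟨hmeas u, ?_, ?_⟩
  · have h1 : eLpNorm (fun x => ⟪g x, u⟫_ℂ) 2 μ ≤
        eLpNorm (fun x => ⟪g' x, u⟫_ℂ) 2 μ + ENNReal.ofReal (η * ‖u‖) := by
      have : (fun x => ⟪g x, u⟫_ℂ) = (fun x => ⟪g' x, u⟫_ℂ) - fun x => ⟪g' x - g x, u⟫_ℂ := by
        rw [hsub]; abel
      rw [this]
      exact (eLpNorm_sub_le hg' hdm one_le_two).trans (by gcongr)
    have h2 : ENNReal.ofReal (√(1 - Δ') * ‖u‖) + ENNReal.ofReal (η * ‖u‖) ≤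
        eLpNorm (fun x => ⟪g' x, u⟫_ℂ) 2 μ + ENNReal.ofReal (η * ‖u‖) := by
      refine le_trans ?_ ((h.le_eLpNorm (hΔ'.trans hΔ1) u).trans h1)
      rw [← ENNReal.ofReal_add (by positivity) (by positivity), ← add_mul]
      gcongr
    -- Subtraction is avoided in `ℝ≥0∞`: the finite error term is cancelled from both sides.
    have h3 := (ENNReal.add_le_add_iff_right ENNReal.ofReal_ne_top).1 h2
    rw [ofReal_le_eLpNorm_two_iff _ (by positivity), mul_pow, Real.sq_sqrt (by linarith)] at h3
    exact h3
  · have h1 : eLpNorm (fun x => ⟪g' x, u⟫_ℂ) 2 μ ≤ ENNReal.ofReal (√(1 + Δ') * ‖u‖) := by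
      have : (fun x => ⟪g' x, u⟫_ℂ) = (fun x => ⟪g x, u⟫_ℂ) + fun x => ⟪g' x - g x, u⟫_ℂ := by
        rw [hsub]; abel
      rw [this]
      refine (eLpNorm_add_le hg hdm one_le_two).trans
        ((add_le_add (h.eLpNorm_le hΔ u) hd).trans ?_)
      rw [← ENNReal.ofReal_add (by positivity) (by positivity), ← add_mul]
      gcongr
    rwa [eLpNorm_two_le_ofReal_iff _ (by positivity), mul_pow, Real.sq_sqrt (by linarith)] at h1

/-! ### Completeness of reproducing kernel spaces -/

/-- Along an `L²`-convergent sequence the integrals against `κ p` converge for every `p`, being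
inner products with a fixed vector, while the values converge almost everywhere along a subsequence.
-/
theorem isClosed_kernelSpace {X : Type*} [MeasurableSpace X] {μ : Measure X} {κ : X → X → ℂ}
    (h : IsReproducingKernel μ κ) : IsClosed (kernelSpace h : Set (Lp ℂ 2 μ)) := by
  refine IsSeqClosed.isClosed fun u v hu huv => ?_
  obtain ⟨φ, hφ, hae⟩ := (tendstoInMeasure_of_tendsto_Lp huv).exists_seq_tendsto_ae
  change ∀ᵐ p ∂μ, _
  have hu' : ∀ᵐ p ∂μ, ∀ k, ∫ q, κ p q * u (φ k) q ∂μ = u (φ k) p :=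
    ae_all_iff.2 fun k => hu (φ k)
  filter_upwards [hae, hu'] with p hp hup
  have hinner : ∀ w : Lp ℂ 2 μ, ⟪(h.memLp_swap p).toLp _, w⟫_ℂ = ∫ q, κ p q * w q ∂μ := by
    intro w
    rw [L2.inner_def]
    refine integral_congr_ae ?_
    filter_upwards [(h.memLp_swap p).coeFn_toLp] with q hq
    rw [RCLike.inner_apply, hq, h.hermitian p q, Complex.conj_conj, mul_comm]
  have hlim : Filter.Tendsto (fun k => ⟪(h.memLp_swap p).toLp _, u (φ k)⟫_ℂ) Filter.atTop
      (nhds ⟪(h.memLp_swap p).toLp _, v⟫_ℂ) :=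
    (tendsto_const_nhds.inner (huv.comp hφ.tendsto_atTop))
  simp only [hinner, hup] at hlim
  exact tendsto_nhds_unique hlim hp

theorem completeSpace_kernelSpace {X : Type*} [MeasurableSpace X] {μ : Measure X}
    {κ : X → X → ℂ} (h : IsReproducingKernel μ κ) : CompleteSpace (kernelSpace h) :=
  (isClosed_kernelSpace h).isComplete.completeSpace_coe

theorem inner_kernelVector_kernelVector {X : Type*} [MeasurableSpace X] {μ : Measure X}
    {κ : X → X → ℂ} (h : IsReproducingKernel μ κ) (p q : X) :
    ⟪kernelVector h p, kernelVector h q⟫_ℂ = κ p q := by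
  rw [inner_kernelVector, ← h.reproduces p q]
  refine integral_congr_ae ?_
  filter_upwards [(h.memLp_swap q).coeFn_toLp] with r hr
  have : ((kernelVector h q : kernelSpace h) : Lp ℂ 2 μ) r = κ r q := hr
  rw [this]

/-! ### Distances and caps on the sphere -/

/-- From `‖x - y‖² = 2 - 2 cos θ` and `cos θ ≥ 1 - θ²/2`. This one direction lets the chordal metric
replace the angle everywhere: cells are small in it, and decay in the angle implies decay in the
chord. -/
theorem dist_le_geodist {n : ℕ} (x y : Sphere n) : dist x y ≤ geodist x y := by
  have hx : ‖(x : EuclideanSpace ℝ (Fin (n + 1)))‖ = 1 := norm_eq_of_mem_sphere x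
  have hy : ‖(y : EuclideanSpace ℝ (Fin (n + 1)))‖ = 1 := norm_eq_of_mem_sphere y
  have habs := abs_le.1 (abs_real_inner_le_norm (x : EuclideanSpace ℝ (Fin (n + 1))) y)
  rw [hx, hy, mul_one] at habs
  have hcos : Real.cos (geodist x y) = ⟪(x : EuclideanSpace ℝ (Fin (n + 1))), y⟫_ℝ :=
    Real.cos_arccos habs.1 habs.2
  have h := Real.one_sub_sq_div_two_le_cos (x := geodist x y)
  refine abs_le_of_sq_le_sq' ?_ (Real.arccos_nonneg _) |>.2
  rw [Subtype.dist_eq, dist_eq_norm, norm_sub_sq_real, hx, hy]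
  rw [hcos] at h
  unfold geodist at h
  linarith

open scoped Pointwise in
-- Surface measure is `n + 1` times the volume of the cone over a set. For `r ≤ 1` the cone over a
-- cap is covered by at most `3 / r` balls of radius `2r` centred along its axis, each of volume of
-- order `r^(n+1)`. For `r > 1` the total mass suffices.
theorem surfaceMeasure_closedBall_le (n : ℕ) :
    ∃ A : ℝ, 0 < A ∧ ∀ (x : Sphere n) (r : ℝ), 0 < r →
      surfaceMeasure n (closedBall x r) ≤ ENNReal.ofReal (A * r ^ n) := by
  have hfin : IsFiniteMeasure (surfaceMeasure n) := by unfold surfaceMeasure; infer_instance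
  set V : ℝ := volume.real (ball (0 : EuclideanSpace ℝ (Fin (n + 1))) 1) with hVdef
  set T : ℝ := (surfaceMeasure n).real univ with hTdef
  have hV : volume (ball (0 : EuclideanSpace ℝ (Fin (n + 1))) 1) = ENNReal.ofReal V :=
    (ofReal_measureReal measure_ball_lt_top.ne).symm
  have hV0 : 0 ≤ V := measureReal_nonneg
  have hT0 : 0 ≤ T := measureReal_nonneg
  refine ⟨(n + 1) * (3 * 2 ^ (n + 1) * V) + T + 1, by positivity, fun x r hr => ?_⟩
  rcases le_or_gt r 1 with h1 | h1
  · set m := ⌈1 / r⌉₊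
    -- The point `t z` is compared with `⌊t / r⌋ r x`: moving `z` to `x` costs at most `r`, and so
    -- does rounding `t`.
    have hsub : (Ioo (0 : ℝ) 1 • (Subtype.val '' closedBall x r) : Set (EuclideanSpace ℝ (Fin (n + 1))))
        ⊆ ⋃ k ∈ Finset.range (m + 1),
          closedBall (((k : ℝ) * r) • (x : EuclideanSpace ℝ (Fin (n + 1)))) (2 * r) := by
      rintro _ ⟨t, ht, _, ⟨z, hz, rfl⟩, rfl⟩
      have hk1 := Nat.floor_le (div_pos ht.1 hr).le
      have hk2 := Nat.lt_floor_add_one (t / r)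
      rw [le_div_iff₀ hr] at hk1
      rw [div_lt_iff₀ hr] at hk2
      refine mem_iUnion₂.2 ⟨⌊t / r⌋₊, ?_, ?_⟩
      · rw [Finset.mem_range, Nat.lt_succ_iff]
        exact (Nat.floor_mono (by gcongr; exact ht.2.le)).trans (Nat.floor_le_ceil _)
      · rw [mem_closedBall, Subtype.dist_eq, dist_eq_norm] at hz
        rw [mem_closedBall, dist_eq_norm]
        have hx : ‖(x : EuclideanSpace ℝ (Fin (n + 1)))‖ = 1 := norm_eq_of_mem_sphere x
        have hsplit : t • (z : EuclideanSpace ℝ (Fin (n + 1))) - ((⌊t / r⌋₊ : ℝ) * r) • x.1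
            = t • ((z : EuclideanSpace ℝ (Fin (n + 1))) - x) +
              (t - (⌊t / r⌋₊ : ℝ) * r) • (x : EuclideanSpace ℝ (Fin (n + 1))) := by
          rw [smul_sub, sub_smul]; abel
        change ‖t • (z : EuclideanSpace ℝ (Fin (n + 1))) - _‖ ≤ _
        rw [hsplit]
        refine (norm_add_le _ _).trans ?_
        rw [norm_smul, norm_smul, hx, Real.norm_of_nonneg ht.1.le,
          Real.norm_of_nonneg (by linarith)]
        nlinarith [norm_nonneg ((z : EuclideanSpace ℝ (Fin (n + 1))) - x), ht.1, ht.2]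
    have hm : ((m + 1 : ℕ) : ℝ) ≤ 3 / r := by
      have h2 := (Nat.ceil_lt_add_one (one_div_pos.2 hr).le).le
      have h3 : 1 ≤ 1 / r := (one_le_div hr).2 h1
      have h4 : 3 / r = 1 / r + 1 / r + 1 / r := by ring
      push_cast
      linarith
    have hdim : Module.finrank ℝ (EuclideanSpace ℝ (Fin (n + 1))) = n + 1 := by simp
    rw [surfaceMeasure, Measure.toSphere_apply' _ measurableSet_closedBall, hdim]
    calc ((n + 1 : ℕ) : ℝ≥0∞) * volume (Ioo (0 : ℝ) 1 • (Subtype.val '' closedBall x r) :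
            Set (EuclideanSpace ℝ (Fin (n + 1))))
        ≤ ((n + 1 : ℕ) : ℝ≥0∞) * ∑ k ∈ Finset.range (m + 1),
          volume (closedBall (((k : ℝ) * r) • (x : EuclideanSpace ℝ (Fin (n + 1)))) (2 * r)) := by
          gcongr
          exact (measure_mono hsub).trans (measure_biUnion_finset_le _ _)
      _ = ENNReal.ofReal ((n + 1 : ℕ) * ((m + 1 : ℕ) * ((2 * r) ^ (n + 1) * V))) := by
          simp_rw [Measure.addHaar_closedBall _ _ (by positivity : 0 ≤ 2 * r), hdim]
          rw [Finset.sum_const, Finset.card_range, nsmul_eq_mul, hV,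
            ← ENNReal.ofReal_mul (by positivity), ← ENNReal.ofReal_natCast (m + 1),
            ← ENNReal.ofReal_mul (by positivity), ← ENNReal.ofReal_natCast (n + 1),
            ← ENNReal.ofReal_mul (by positivity)]
      _ ≤ _ := by
          refine ENNReal.ofReal_le_ofReal ?_
          calc ((n + 1 : ℕ) : ℝ) * ((m + 1 : ℕ) * ((2 * r) ^ (n + 1) * V))
              ≤ ((n + 1 : ℕ) : ℝ) * (3 / r * ((2 * r) ^ (n + 1) * V)) := by gcongr
            _ = (n + 1) * (3 * 2 ^ (n + 1) * V) * r ^ n := by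
              push_cast
              rw [mul_pow, pow_succ r]
              field_simp
            _ ≤ _ := by
              have : 0 ≤ r ^ n := by positivity
              nlinarith
  · calc surfaceMeasure n (closedBall x r) ≤ surfaceMeasure n univ := measure_mono (subset_univ _)
      _ = ENNReal.ofReal T := (ofReal_measureReal (measure_ne_top _ _)).symm
      _ ≤ _ := by
        refine ENNReal.ofReal_le_ofReal ?_
        have h2 : 1 ≤ r ^ n := one_le_pow₀ h1.le
        have h3 : 0 ≤ (n + 1) * (3 * 2 ^ (n + 1) * V) := by positivity
        nlinarith

/-- Integrals of powers of the distance in a space whose balls have at most `n`-dimensional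
volume growth. -/
theorem lintegral_rpow_dist_le {Z : Type*} [PseudoMetricSpace Z] [MeasurableSpace Z]
    [OpensMeasurableSpace Z] {σ : Measure Z} {n : ℕ} {A : ℝ} (hA : 0 ≤ A) {x : Z}
    (hσ : ∀ r : ℝ, 0 < r → σ (closedBall x r) ≤ ENNReal.ofReal (A * r ^ n))
    {N : ℝ} (hN : (n : ℝ) + 1 ≤ N) {c : ℝ} (hc : 0 < c) :
    ∫⁻ z, ENNReal.ofReal ((c + dist x z) ^ (-N)) ∂σ ≤
      ENNReal.ofReal (2 * (A * 2 ^ N) * c ^ ((n : ℝ) - N)) := by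
  have hN0 : 0 ≤ N := by have : (0 : ℝ) ≤ n := n.cast_nonneg; linarith
  -- Dyadic decomposition: for the least `k` with `dist x z ≤ 2^k c`, minimality gives `c + dist x z
  -- ≥ 2^k c / 2`.
  have hpt : ∀ z, ENNReal.ofReal ((c + dist x z) ^ (-N)) ≤
      ∑' k : ℕ, (closedBall x (2 ^ k * c)).indicator
        (fun _ => ENNReal.ofReal ((2 ^ k * c / 2) ^ (-N))) z := by
    intro z
    have hex : ∃ k : ℕ, dist x z ≤ 2 ^ k * c := by
      obtain ⟨k, hk⟩ := pow_unbounded_of_one_lt (dist x z / c) one_lt_two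
      exact ⟨k, ((div_lt_iff₀ hc).1 hk).le⟩
    classical
    obtain ⟨k, hk, hlow⟩ : ∃ k : ℕ, dist x z ≤ 2 ^ k * c ∧ 2 ^ k * c / 2 ≤ c + dist x z := by
      refine ⟨Nat.find hex, Nat.find_spec hex, ?_⟩
      rcases hm : Nat.find hex with _ | m
      · have := dist_nonneg (x := x) (y := z)
        simp only [pow_zero, one_mul]
        linarith
      · have := not_le.1 (Nat.find_min hex (m := m) (by omega))
        rw [pow_succ]
        linarith
    refine le_trans ?_ (ENNReal.le_tsum k)
    rw [indicator_of_mem (by rwa [mem_closedBall'])]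
    exact ENNReal.ofReal_le_ofReal
      (Real.rpow_le_rpow_of_nonpos (by positivity) hlow (neg_nonpos.2 hN0))
  calc ∫⁻ z, ENNReal.ofReal ((c + dist x z) ^ (-N)) ∂σ
      ≤ ∫⁻ z, ∑' k : ℕ, (closedBall x (2 ^ k * c)).indicator
        (fun _ => ENNReal.ofReal ((2 ^ k * c / 2) ^ (-N))) z ∂σ := lintegral_mono hpt
    _ = ∑' k : ℕ, ENNReal.ofReal ((2 ^ k * c / 2) ^ (-N)) * σ (closedBall x (2 ^ k * c)) := by
        rw [lintegral_tsum fun k =>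
          (measurable_const.indicator measurableSet_closedBall).aemeasurable]
        congr 1
        funext k
        rw [lintegral_indicator measurableSet_closedBall, setLIntegral_const]
    _ ≤ ∑' k : ℕ, ENNReal.ofReal (A * 2 ^ N * c ^ ((n : ℝ) - N)) * (2⁻¹ : ℝ≥0∞) ^ k := by
        refine ENNReal.tsum_le_tsum fun k => ?_
        have h2 : (2⁻¹ : ℝ≥0∞) ^ k = ENNReal.ofReal ((2 ^ k : ℝ)⁻¹) := by
          rw [ENNReal.ofReal_inv_of_pos (by positivity), ENNReal.ofReal_pow (by norm_num),
            ENNReal.ofReal_ofNat, ENNReal.inv_pow]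
        rw [h2, ← ENNReal.ofReal_mul (by positivity)]
        refine (mul_le_mul_right (hσ _ (by positivity)) _).trans ?_
        rw [← ENNReal.ofReal_mul (by positivity)]
        refine ENNReal.ofReal_le_ofReal ?_
        have hk0 : (0 : ℝ) < 2 ^ k := by positivity
        -- Here `N ≥ n + 1` enters: the dyadic terms decay at least like `2^(-k)`.
        have h3 : ((2 : ℝ) ^ k) ^ ((n : ℝ) - N) ≤ (2 ^ k)⁻¹ := by
          rw [← Real.rpow_neg_one]
          exact Real.rpow_le_rpow_of_exponent_le (one_le_pow₀ one_le_two) (by linarith)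
        calc (2 ^ k * c / 2) ^ (-N) * (A * (2 ^ k * c) ^ n)
            = A * 2 ^ N * c ^ ((n : ℝ) - N) * ((2 : ℝ) ^ k) ^ ((n : ℝ) - N) := by
              rw [Real.div_rpow (by positivity) zero_le_two, Real.rpow_neg zero_le_two,
                div_inv_eq_mul, ← Real.rpow_natCast (2 ^ k * c), mul_assoc (A * 2 ^ N),
                ← Real.mul_rpow hc.le hk0.le, mul_comm c, sub_eq_add_neg,
                Real.rpow_add (by positivity)]
              ring
          _ ≤ _ := by gcongr
    _ = _ := by
        rw [ENNReal.tsum_mul_left, ENNReal.tsum_geometric_two, mul_comm, ← ENNReal.ofReal_ofNat,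
          ← ENNReal.ofReal_mul zero_le_two, mul_assoc 2 (A * 2 ^ N)]

/-! ### Radial extension and the mean value inequality -/

theorem radialExt_coe {n : ℕ} (f : Sphere n → ℂ) (x : Sphere n) :
    radialExt f (x : EuclideanSpace ℝ (Fin (n + 1))) = f x := by
  have hx : ‖(x : EuclideanSpace ℝ (Fin (n + 1)))‖ = 1 := norm_eq_of_mem_sphere x
  have h0 : (x : EuclideanSpace ℝ (Fin (n + 1))) ≠ 0 := norm_ne_zero_iff.1 (by rw [hx]; simp)
  rw [radialExt, dif_neg h0]
  congr 1
  ext1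
  simp only [hx, inv_one, one_smul]

theorem radialExt_smul {n : ℕ} (f : Sphere n → ℂ) {s : ℝ} (hs : 0 < s)
    (v : EuclideanSpace ℝ (Fin (n + 1))) : radialExt f (s • v) = radialExt f v := by
  by_cases hv : v = 0
  · rw [hv, smul_zero]
  · rw [radialExt, radialExt, dif_neg hv, dif_neg (smul_ne_zero hs.ne' hv)]
    congr 1
    ext1
    simp only
    rw [norm_smul, Real.norm_of_nonneg hs.le, smul_smul, mul_inv, mul_right_comm,
      inv_mul_cancel₀ hs.ne', one_mul]

theorem norm_fderiv_radialExt_le {n : ℕ} (f : Sphere n → ℂ) (w : Sphere n)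
    (u : EuclideanSpace ℝ (Fin (n + 1))) :
    ‖fderiv ℝ (radialExt f) (w : EuclideanSpace ℝ (Fin (n + 1))) u‖ ≤
      ‖surfaceGradient f w‖ * ‖u‖ := by
  set D := fderiv ℝ (radialExt f) (w : EuclideanSpace ℝ (Fin (n + 1))) with hD
  have hu : u = ∑ i, u i • EuclideanSpace.single i (1 : ℝ) := by
    have h := (EuclideanSpace.basisFun (Fin (n + 1)) ℝ).sum_repr u
    simpa using h.symm
  calc ‖D u‖ = ‖∑ i, u i • D (EuclideanSpace.single i (1 : ℝ))‖ := by
        conv_lhs => rw [hu]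
        simp only [map_sum, map_smul]
    _ ≤ ∑ i, ‖D (EuclideanSpace.single i (1 : ℝ))‖ * ‖u i‖ := by
        refine (norm_sum_le _ _).trans (Finset.sum_le_sum fun i _ => ?_)
        rw [norm_smul, mul_comm]
    _ ≤ √(∑ i, ‖D (EuclideanSpace.single i (1 : ℝ))‖ ^ 2) * √(∑ i, ‖u i‖ ^ 2) :=
        Real.sum_mul_le_sqrt_mul_sqrt _ _ _
    _ = _ := by rw [EuclideanSpace.norm_eq, EuclideanSpace.norm_eq]; rfl

/-- Mean value inequality along the chord instead of the geodesic. Homogeneity moves the derivative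
at a chord point to its radial projection, at the cost of a factor `‖c t‖⁻¹ ≤ 2`; the projection
stays within `2 * dist x y` of `x`. -/
theorem norm_sub_le_of_surfaceGradient_le {n : ℕ} {f : Sphere n → ℂ}
    (hf : ∀ w, SphereDifferentiableAt f w) {x y : Sphere n} (hxy : dist x y ≤ 1 / 2) {M : ℝ}
    (hM : ∀ w, dist x w ≤ 2 * dist x y → ‖surfaceGradient f w‖ ≤ M) :
    ‖f y - f x‖ ≤ M * (2 * dist x y) := by
  have hM0 : 0 ≤ M := (norm_nonneg _).trans (hM x (by rw [dist_self]; positivity))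
  have hx : ‖(x : EuclideanSpace ℝ (Fin (n + 1)))‖ = 1 := norm_eq_of_mem_sphere x
  set v : EuclideanSpace ℝ (Fin (n + 1)) := y - x with hv
  have hvn : ‖v‖ = dist x y := by rw [dist_comm, Subtype.dist_eq, dist_eq_norm]
  set c : ℝ → EuclideanSpace ℝ (Fin (n + 1)) := fun t => x + t • v with hcdef
  have hcx : ∀ t ∈ Icc (0 : ℝ) 1, ‖(x : EuclideanSpace ℝ (Fin (n + 1))) - c t‖ ≤ dist x y := by
    intro t ht
    rw [hcdef]
    simp only [sub_add_cancel_left, norm_neg, norm_smul, Real.norm_of_nonneg ht.1, hvn]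
    exact mul_le_of_le_one_left dist_nonneg ht.2
  have hcn : ∀ t ∈ Icc (0 : ℝ) 1, |1 - ‖c t‖| ≤ dist x y := fun t ht => by
    have h := (abs_norm_sub_norm_le _ _).trans (hcx t ht)
    rwa [hx] at h
  have hch : ∀ t ∈ Icc (0 : ℝ) 1, 1 / 2 ≤ ‖c t‖ := fun t ht => by
    have := (abs_le.1 (hcn t ht)).2
    linarith
  have hderiv : ∀ t ∈ Icc (0 : ℝ) 1, ∃ D : ℂ, HasDerivAt (fun t => radialExt f (c t)) D t ∧
      ‖D‖ ≤ M * (2 * dist x y) := by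
    intro t ht
    have hpos : 0 < ‖c t‖ := by linarith [hch t ht]
    have hw1 : ‖‖c t‖⁻¹ • c t‖ = 1 := by
      rw [norm_smul, norm_inv, norm_norm, inv_mul_cancel₀ hpos.ne']
    set w : Sphere n := ⟨‖c t‖⁻¹ • c t, by rwa [mem_sphere_zero_iff_norm]⟩ with hw
    have hwc : ‖c t - ‖c t‖⁻¹ • c t‖ ≤ dist x y := by
      have h1 : c t - ‖c t‖⁻¹ • c t = (‖c t‖ - 1) • (‖c t‖⁻¹ • c t) := by
        rw [smul_smul, sub_mul, mul_inv_cancel₀ hpos.ne', sub_smul, one_smul, one_mul]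
      rw [h1, norm_smul, hw1, mul_one, Real.norm_eq_abs, abs_sub_comm]
      exact hcn t ht
    have hwx : dist x w ≤ 2 * dist x y := by
      rw [Subtype.dist_eq, dist_eq_norm]
      have := norm_sub_le_norm_sub_add_norm_sub (x : EuclideanSpace ℝ (Fin (n + 1))) (c t) w
      have h2 := hcx t ht
      have h3 : ‖c t - w‖ ≤ dist x y := hwc
      linarith
    have hF : HasFDerivAt (radialExt f) (fderiv ℝ (radialExt f) (w : EuclideanSpace ℝ _))
        (‖c t‖⁻¹ • c t) := (hf w).hasFDerivAt
    -- The scaling factor is frozen at `t`, so this is still a straight line. It meets the sphere at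
    -- `t' = t`, where differentiability is known, and the radial extension takes the same values
    -- along it as along `c`.
    have hline : HasDerivAt (fun t' => ‖c t‖⁻¹ • c t') (‖c t‖⁻¹ • v) t := by
      have h1 : HasDerivAt c v t := by
        have h := ((hasDerivAt_id t).smul_const v).const_add
          (x : EuclideanSpace ℝ (Fin (n + 1)))
        rw [one_smul] at h
        exact h
      exact h1.const_smul ‖c t‖⁻¹
    refine ⟨fderiv ℝ (radialExt f) (w : EuclideanSpace ℝ _) (‖c t‖⁻¹ • v), ?_, ?_⟩
    · have h := hF.comp_hasDerivAt t hline
      refine h.congr_of_eventuallyEq (Filter.Eventually.of_forall fun t' => ?_)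
      exact (radialExt_smul f (inv_pos.2 hpos) _).symm
    · refine (norm_fderiv_radialExt_le f w _).trans ?_
      rw [norm_smul, norm_inv, norm_norm, hvn]
      have h4 : ‖c t‖⁻¹ ≤ 2 := by
        rw [inv_le_comm₀ hpos two_pos]
        linarith [hch t ht]
      have := hM w hwx
      gcongr
  choose! D hD hDn using hderiv
  have := norm_image_sub_le_of_norm_deriv_le_segment_01'
    (fun t ht => (hD t ht).hasDerivWithinAt) fun t ht => hDn t (Ico_subset_Icc_self ht)
  simpa [hcdef, hv, radialExt_coe] using this

/-! ### Localized kernels -/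

/-- The two ranges cover all angles because `ε' < 2 - ε'`. In the near range `D ≤ θ ≤ 2ω(a + b)`, in
the far range `a + b ≤ θ / ω`; so the respective denominator base, `a + b` or `θ`, dominates `a + b
+ D` up to the factor `1 + 2ω + 1/ω`. -/
theorem TwoRegimeBound.le {n : ℕ} {d ω ε ε' a b θ t D : ℝ} (h : TwoRegimeBound n d ω ε ε' a b θ t)
    (hd : 0 < d) (hω : 0 < ω) (hε : 0 < ε) (hε'0 : 0 < ε') (hε'1 : ε' < 1 / 2)
    (ha : 0 < a) (hb : 0 < b) (hD0 : 0 ≤ D) (hD : D ≤ θ) :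
    t ≤ d * (1 + 2 * ω + 1 / ω) ^ (3 * (n : ℝ) + 2 * ε) *
      ((a * b) ^ ((n : ℝ) + ε) * (a + b + D) ^ (-(3 * (n : ℝ) + 2 * ε))) := by
  set N := 3 * (n : ℝ) + 2 * ε with hN
  set c := 1 + 2 * ω + 1 / ω with hc
  have hN0 : 0 ≤ N := by positivity
  have hc0 : 0 < c := by positivity
  have key : ∀ r : ℝ, 0 < r → a + b + D ≤ c * r →
      (a * b) ^ ((n : ℝ) + ε) * (d / r ^ N) ≤
        d * c ^ N * ((a * b) ^ ((n : ℝ) + ε) * (a + b + D) ^ (-N)) := by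
    intro r hr hle
    have h1 : (c * r) ^ (-N) ≤ (a + b + D) ^ (-N) :=
      Real.rpow_le_rpow_of_nonpos (by positivity) hle (neg_nonpos.2 hN0)
    calc (a * b) ^ ((n : ℝ) + ε) * (d / r ^ N)
        = d * c ^ N * ((a * b) ^ ((n : ℝ) + ε) * (c * r) ^ (-N)) := by
          rw [Real.rpow_neg (by positivity), Real.mul_rpow hc0.le hr.le]
          have : c ^ N ≠ 0 := by positivity
          field_simp
      _ ≤ _ := by gcongr
  have hωi : 0 < 1 / ω := by positivity
  rcases le_or_gt θ (ω * (a + (2 - ε') * b)) with hθ | hθ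
  · refine (h.1 hθ).trans (key (a + b) (by positivity) ?_)
    have : 0 < 1 / ω * (a + b) := by positivity
    have h2 : ω * (a + (2 - ε') * b) ≤ 2 * ω * (a + b) := by
      have := mul_pos hω ha
      have := mul_pos (mul_pos hω hε'0) hb
      nlinarith
    rw [hc]
    nlinarith
  · have hle : ω * (a + b) ≤ θ := by
      have := mul_pos hω hb
      nlinarith
    have hθ0 : 0 < θ := lt_of_lt_of_le (by positivity) hle
    refine (h.2 (lt_of_le_of_lt ?_ hθ)).trans (key θ hθ0 ?_)
    · gcongr
      linarith
    · have h3 : a + b ≤ 1 / ω * θ := by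
        rw [one_div, ← div_eq_inv_mul, le_div_iff₀ hω]
        linarith
      have : 0 < ω * θ := by positivity
      rw [hc]
      nlinarith

/-- A localized kernel is Lipschitz in the first spherical variable on the scale of that
variable. -/
theorem IsLocalized.norm_sub_le {n : ℕ} {κ : Param n → Param n → ℂ} {bmax d ω ε ε' : ℝ}
    (h : IsLocalized κ bmax d ω ε ε') (hd : 0 < d) (hω : 0 < ω) (hε : 0 < ε) (hε'0 : 0 < ε')
    (hε'1 : ε' < 1 / 2) {ρ : ℝ} (hρ : ρ ≤ 1 / 4) {a b : Scale} (ha : (a : ℝ) ≤ bmax)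
    (hb : (b : ℝ) ≤ bmax) (hρa : ρ * (a : ℝ) ≤ 1 / 2) {x y : Sphere n}
    (hxy : dist x y ≤ ρ * a) (z : Sphere n) :
    ‖κ (a, y) (b, z) - κ (a, x) (b, z)‖ ≤
      ρ * (2 * (2 ^ (3 * (n : ℝ) + 2 * ε) * (d * (1 + 2 * ω + 1 / ω) ^ (3 * (n : ℝ) + 2 * ε)))) *
        (((a : ℝ) * b) ^ ((n : ℝ) + ε) *
          ((a : ℝ) + b + dist x z) ^ (-(3 * (n : ℝ) + 2 * ε))) := by
  set N := 3 * (n : ℝ) + 2 * ε with hN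
  set C₀ := d * (1 + 2 * ω + 1 / ω) ^ N with hC₀
  have hC₀0 : 0 ≤ C₀ := by positivity
  have hN0 : 0 ≤ N := by positivity
  have ha0 : (0 : ℝ) < a := a.2
  have hb0 : (0 : ℝ) < b := b.2
  have hab : (0 : ℝ) < a + b := by linarith
  set P := ((a : ℝ) * b) ^ ((n : ℝ) + ε) with hP
  have hP0 : 0 ≤ P := by positivity
  have hgrad : ∀ w, dist x w ≤ 2 * dist x y →
      ‖surfaceGradient (fun x' => κ (a, x') (b, z)) w‖ ≤
        (2 ^ N * C₀ * (P * ((a : ℝ) + b + dist x z) ^ (-N))) / ((a : ℝ) + b) := by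
    intro w hw
    rw [le_div_iff₀' hab]
    refine ((h a b ha hb w z).2.2.2.1.le hd hω hε hε'0 hε'1 ha0 hb0 dist_nonneg
      (dist_le_geodist w z)).trans ?_
    -- As `dist x w ≤ 2ρa ≤ a / 2`, moving from `x` to `w` changes the decay by a bounded factor
    -- only.
    have hle : (a + b + dist x z) / 2 ≤ (a : ℝ) + b + dist w z := by
      have h1 := dist_triangle x w z
      have h2 : ρ * (a : ℝ) ≤ 1 / 4 * a := by gcongr
      have h3 := dist_nonneg (x := w) (y := z)
      linarith
    have hpow : ((a : ℝ) + b + dist w z) ^ (-N) ≤ 2 ^ N * ((a : ℝ) + b + dist x z) ^ (-N) := by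
      refine (Real.rpow_le_rpow_of_nonpos (by positivity) hle (neg_nonpos.2 hN0)).trans_eq ?_
      rw [Real.div_rpow (by positivity) zero_le_two, Real.rpow_neg zero_le_two, div_inv_eq_mul,
        mul_comm]
    calc C₀ * (P * ((a : ℝ) + b + dist w z) ^ (-N))
        ≤ C₀ * (P * (2 ^ N * ((a : ℝ) + b + dist x z) ^ (-N))) := by gcongr
      _ = _ := by ring
  refine (norm_sub_le_of_surfaceGradient_le (f := fun x' => κ (a, x') (b, z))
    (fun w => (h a b ha hb w z).1) (hxy.trans hρa) hgrad).trans ?_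
  -- The factor `1 / (a + b)` in the gradient bound is what makes a step of length `ρ a` cost only
  -- `ρ`.
  have hq : dist x y / ((a : ℝ) + b) ≤ ρ := by
    rw [div_le_iff₀ hab]
    have hρ0 : 0 ≤ ρ := nonneg_of_mul_nonneg_left (dist_nonneg.trans hxy) ha0
    nlinarith
  calc (2 ^ N * C₀ * (P * ((a : ℝ) + b + dist x z) ^ (-N))) / ((a : ℝ) + b) * (2 * dist x y)
      = dist x y / ((a : ℝ) + b) * (2 * (2 ^ N * C₀)) *
        (P * ((a : ℝ) + b + dist x z) ^ (-N)) := by ring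
    _ ≤ _ := by gcongr

/-! ### Sequences of scales -/

theorem scale_add_le {b : ℕ → Scale} {δ' : ℝ} (hδ' : 1 < δ')
    (hb : ∀ j, δ' ≤ (b j : ℝ) / b (j + 1)) (j k : ℕ) :
    (b (j + k) : ℝ) ≤ δ'⁻¹ ^ k * b j := by
  induction k with
  | zero => simp
  | succ k ih =>
    have hpos : (0 : ℝ) < b (j + k + 1) := (b _).2
    have h1 := (le_div_iff₀ hpos).1 (hb (j + k))
    have h2 : (b (j + k + 1) : ℝ) ≤ δ'⁻¹ * b (j + k) := by
      rw [← div_eq_inv_mul, le_div_iff₀ (by linarith)]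
      linarith
    calc (b (j + (k + 1)) : ℝ) ≤ δ'⁻¹ * b (j + k) := h2
      _ ≤ δ'⁻¹ * (δ'⁻¹ ^ k * b j) := by gcongr
      _ = _ := by ring

theorem scale_le_scale_zero {b : ℕ → Scale} {δ' : ℝ} (hδ' : 1 < δ')
    (hb : ∀ j, δ' ≤ (b j : ℝ) / b (j + 1)) (j : ℕ) : (b j : ℝ) ≤ b 0 := by
  have h := scale_add_le hδ' hb 0 j
  rw [zero_add] at h
  have h0 : (0 : ℝ) < b 0 := (b 0).2
  exact h.trans (mul_le_of_le_one_left h0.le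
    (pow_le_one₀ (by positivity) (inv_le_one_of_one_le₀ hδ'.le)))

theorem mul_div_sq_add_le_of_le {a b q : ℝ} (ha : 0 < a) (hb : 0 < b) (h : b ≤ q * a) :
    a * b / (a + b) ^ 2 ≤ q := by
  rw [div_le_iff₀ (by positivity)]
  have hq : 0 ≤ q := nonneg_of_mul_nonneg_left (hb.le.trans h) ha
  have h1 : a * b ≤ q * (a * a) := by nlinarith
  have h2 : q * (a * a) ≤ q * (a + b) ^ 2 := by
    gcongr
    nlinarith
  exact h1.trans h2

/-- The left side is at most the ratio of the smaller scale to the larger. This is the source of the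
almost orthogonality of distant levels. -/
theorem scale_mul_div_sq_add_le {b : ℕ → Scale} {δ' : ℝ} (hδ' : 1 < δ')
    (hb : ∀ j, δ' ≤ (b j : ℝ) / b (j + 1)) (i j : ℕ) :
    (b j : ℝ) * b i / ((b j : ℝ) + b i) ^ 2 ≤ δ'⁻¹ ^ ((i : ℤ) - j).natAbs := by
  rcases le_total j i with h | h
  · obtain ⟨k, rfl⟩ := Nat.exists_eq_add_of_le h
    have : (((j + k : ℕ) : ℤ) - j).natAbs = k := by omega
    rw [this]
    exact mul_div_sq_add_le_of_le (b j).2 (b _).2 (scale_add_le hδ' hb j k)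
  · obtain ⟨k, rfl⟩ := Nat.exists_eq_add_of_le h
    have : ((i : ℤ) - (i + k : ℕ)).natAbs = k := by omega
    rw [this, mul_comm (b _ : ℝ), add_comm (b _ : ℝ)]
    exact mul_div_sq_add_le_of_le (b i).2 (b _).2 (scale_add_le hδ' hb i k)

theorem scaleWeight_le {b : ℕ → Scale} {δ : ℝ} (hb : ∀ j, (b j : ℝ) / b (j + 1) ≤ δ) (j : ℕ) :
    scaleWeight b j ≤ Real.log δ :=
  Real.log_le_log (div_pos (b _).2 (b _).2) (hb j)

theorem le_scaleWeight {b : ℕ → Scale} {δ' : ℝ} (hδ' : 1 < δ')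
    (hb : ∀ j, δ' ≤ (b j : ℝ) / b (j + 1)) (j : ℕ) : Real.log δ' ≤ scaleWeight b j :=
  Real.log_le_log (by linarith) (hb j)

/-! ### The measure on the levels -/

/-- The measure `∑_j w_j δ_j ⊗ σ` on `ℕ × 𝒮ⁿ`. -/
noncomputable def levelMeasure (n : ℕ) (w : ℕ → ℝ) : Measure (ℕ × Sphere n) :=
  Measure.sum fun j => ENNReal.ofReal (w j) • (surfaceMeasure n).map (Prod.mk j)

instance (n : ℕ) : IsFiniteMeasure (surfaceMeasure n) := by
  unfold surfaceMeasure
  infer_instance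

instance (n : ℕ) (w : ℕ → ℝ) : SFinite (levelMeasure n w) := by
  unfold levelMeasure
  infer_instance

theorem lintegral_levelMeasure (n : ℕ) (w : ℕ → ℝ) (F : ℕ × Sphere n → ℝ≥0∞) :
    ∫⁻ p, F p ∂levelMeasure n w =
      ∑' j, ENNReal.ofReal (w j) * ∫⁻ x, F (j, x) ∂surfaceMeasure n := by
  rw [levelMeasure, lintegral_sum_measure]
  congr 1
  funext j
  rw [lintegral_smul_measure, (measurableEmbedding_prodMk_left j).lintegral_map, smul_eq_mul]

theorem map_levelMeasure (n : ℕ) (b : ℕ → Scale) (C : ℝ) :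
    (levelMeasure n fun j => C * scaleWeight b j).map (fun p => (b p.1, p.2)) =
      semiDiscreteMeasure n b C := by
  have hm : Measurable fun p : ℕ × Sphere n => (b p.1, p.2) :=
    (measurable_from_nat.comp measurable_fst).prodMk measurable_snd
  rw [levelMeasure, semiDiscreteMeasure, Measure.map_sum hm.aemeasurable]
  congr 1
  funext j
  rw [Measure.map_smul, Measure.map_map hm measurable_prodMk_left, Measure.dirac_prod]
  rfl

theorem IsFrameWith.comp_map {X Y : Type*} [MeasurableSpace X] [MeasurableSpace Y] {E : Type*}
    [NormedAddCommGroup E] [InnerProductSpace ℂ E] {g : X → E} {μ : Measure Y} {φ : Y → X}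
    (hφ : Measurable φ) {Δ : ℝ} (h : IsFrameWith g (μ.map φ) Δ) :
    IsFrameWith (fun y => g (φ y)) μ Δ := by
  intro u
  obtain ⟨h1, h2, h3⟩ := h u
  have hint : ∫⁻ x, ‖⟪g x, u⟫_ℂ‖ₑ ^ 2 ∂μ.map φ = ∫⁻ y, ‖⟪g (φ y), u⟫_ℂ‖ₑ ^ 2 ∂μ :=
    lintegral_map' (h1.enorm.pow_const 2) hφ.aemeasurable
  rw [hint] at h2 h3
  exact ⟨h1.comp_measurable hφ, h2, h3⟩

/-! ### Grids -/

namespace Grid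

variable {n : ℕ} {b : ℕ → Scale} {δ Ξ : ℝ} (G : Grid n b δ Ξ)

theorem exists_mem_cell (j : ℕ) (x : Sphere n) : ∃ k, x ∈ G.cell j k :=
  mem_iUnion.1 (G.iUnion_cell j ▸ mem_univ x)

/-- The index of the cell that contains a point of the sphere. -/
noncomputable def index (j : ℕ) (x : Sphere n) : Fin (G.card j) := (G.exists_mem_cell j x).choose

theorem mem_cell_index (j : ℕ) (x : Sphere n) : x ∈ G.cell j (G.index j x) :=
  (G.exists_mem_cell j x).choose_spec

theorem index_preimage_singleton (j : ℕ) (k : Fin (G.card j)) :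
    G.index j ⁻¹' {k} = G.cell j k := by
  ext x
  refine ⟨fun h => ?_, fun h => ?_⟩
  · have := G.mem_cell_index j x
    rwa [mem_singleton_iff.1 h] at this
  · by_contra hne
    exact disjoint_left.1 (G.disjoint_cell j hne) (G.mem_cell_index j x) h

theorem measurable_index (j : ℕ) : Measurable (G.index j) :=
  measurable_to_countable' fun k => by
    rw [G.index_preimage_singleton]
    exact G.measurableSet_cell j k

/-- The grid point in the cell that contains a given point. -/
noncomputable def nearest (p : ℕ × Sphere n) : Param n :=
  (b p.1, G.point p.1 (G.index p.1 p.2))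

/-- No measurability of `F` is needed: at each level the composition is constant on each of finitely
many measurable cells. -/
theorem measurable_comp_nearest {Z : Type*} [MeasurableSpace Z] (F : Param n → Z) :
    Measurable fun p => F (G.nearest p) := by
  refine measurable_from_prod_countable_right fun j => ?_
  exact (measurable_from_top (f := fun k => F (b j, G.point j k))).comp (G.measurable_index j)

theorem dist_nearest_le (j : ℕ) (x : Sphere n) : dist x (G.nearest (j, x)).2 ≤ Ξ * b j :=
  (dist_le_geodist _ _).trans
    (G.diam_cell j _ _ (G.mem_cell_index j x) _ (G.point_mem j _))

/-- At level `j` the index map pushes `σ` forward to the masses of the cells, so the integral over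
the sphere is a finite sum. -/
theorem lintegral_pointMeasure (w : ℕ → ℝ) (F : Param n → ℝ≥0∞) :
    ∫⁻ p, F p ∂G.pointMeasure w = ∫⁻ p, F (G.nearest p) ∂levelMeasure n w := by
  rw [lintegral_levelMeasure, pointMeasure, lintegral_sum_measure]
  simp only [lintegral_smul_measure, lintegral_dirac, smul_eq_mul]
  rw [ENNReal.tsum_sigma' (f := fun i : (Σ j, Fin (G.card j)) =>
    ENNReal.ofReal (w i.1) * surfaceMeasure n (G.cell i.1 i.2) * F (b i.1, G.point i.1 i.2))]
  congr 1
  funext j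
  have h : ∫⁻ x, F (G.nearest (j, x)) ∂surfaceMeasure n =
      ∫⁻ k, F (b j, G.point j k) ∂(surfaceMeasure n).map (G.index j) :=
    (lintegral_map (f := fun k => F (b j, G.point j k)) measurable_from_top
      (G.measurable_index j)).symm
  rw [h, lintegral_fintype, tsum_fintype, Finset.mul_sum]
  refine Finset.sum_congr rfl fun k _ => ?_
  rw [Measure.map_apply (G.measurable_index j) (measurableSet_singleton k),
    G.index_preimage_singleton]
  ring

theorem aemeasurable_pointMeasure {Z : Type*} [MeasurableSpace Z] [Nonempty Z] (w : ℕ → ℝ)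
    (F : Param n → Z) :
    AEMeasurable F (G.pointMeasure w) := by
  rw [pointMeasure, aemeasurable_sum_measure_iff]
  exact fun i => aemeasurable_dirac.smul_measure _

theorem isFrameWith_pointMeasure {E : Type*} [NormedAddCommGroup E] [InnerProductSpace ℂ E]
    {g : Param n → E} {w : ℕ → ℝ} {Δ : ℝ}
    (h : IsFrameWith (fun p => g (G.nearest p)) (levelMeasure n w) Δ) :
    IsFrameWith g (G.pointMeasure w) Δ := fun u => by
  rw [G.lintegral_pointMeasure w fun p => ‖⟪g p, u⟫_ℂ‖ₑ ^ 2]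
  exact ⟨G.aemeasurable_pointMeasure w _, (h u).2⟩

end Grid

/-! ### Almost orthogonality of the levels -/

/-- The model of a localized kernel on `ℕ × 𝒮ⁿ`. -/
noncomputable def levelKernel (n : ℕ) (b : ℕ → Scale) (ε M : ℝ) (p q : ℕ × Sphere n) : ℝ≥0∞ :=
  ENNReal.ofReal (M * (((b p.1 : ℝ) * b q.1) ^ ((n : ℝ) + ε) *
    ((b p.1 : ℝ) + b q.1 + dist p.2 q.2) ^ (-(3 * (n : ℝ) + 2 * ε))))

theorem levelKernel_comm (n : ℕ) (b : ℕ → Scale) (ε M : ℝ) (p q : ℕ × Sphere n) :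
    levelKernel n b ε M p q = levelKernel n b ε M q p := by
  rw [levelKernel, levelKernel, mul_comm (b p.1 : ℝ), add_comm (b p.1 : ℝ), dist_comm]

theorem measurable_levelKernel (n : ℕ) (b : ℕ → Scale) (ε M : ℝ) :
    Measurable (Function.uncurry (levelKernel n b ε M)) := by
  have hb : Measurable fun j => (b j : ℝ) := measurable_from_nat
  have h1 : Measurable fun r : (ℕ × Sphere n) × (ℕ × Sphere n) => (b r.1.1 : ℝ) :=
    hb.comp (measurable_fst.comp measurable_fst)
  have h2 : Measurable fun r : (ℕ × Sphere n) × (ℕ × Sphere n) => (b r.2.1 : ℝ) :=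
    hb.comp (measurable_fst.comp measurable_snd)
  have h3 : Measurable fun r : (ℕ × Sphere n) × (ℕ × Sphere n) => dist r.1.2 r.2.2 :=
    (measurable_snd.comp measurable_fst).dist (measurable_snd.comp measurable_snd)
  exact ((((h1.mul h2).pow_const _).mul (((h1.add h2).add h3).pow_const _)).const_mul
    M).ennreal_ofReal

/-- Integration over the sphere leaves `(b_j + b_i)^(n - N)` with `n - N = -2(n + ε)`, exactly the
power that makes the product with `(b_j b_i)^(n + ε)` scale invariant; the sum over levels is then
geometric. Since `L` does not depend on `M`, a small `M` gives a small Schur bound. -/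
theorem lintegral_levelKernel_le {n : ℕ} (hn : 1 ≤ n) {b : ℕ → Scale} {δ δ' C ε : ℝ}
    (hδ' : 1 < δ') (hlow : ∀ j, δ' ≤ (b j : ℝ) / b (j + 1)) (hup : ∀ j, (b j : ℝ) / b (j + 1) ≤ δ)
    (hC : 0 < C) (hε : 0 < ε) :
    ∃ L : ℝ, 0 < L ∧ ∀ M : ℝ, 0 ≤ M → ∀ p : ℕ × Sphere n,
      ∫⁻ q, levelKernel n b ε M p q ∂levelMeasure n (fun j => C * scaleWeight b j) ≤
        ENNReal.ofReal (M * L) := by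
  obtain ⟨A, hA, hcap⟩ := surfaceMeasure_closedBall_le n
  have hlogδ : 0 < Real.log δ := Real.log_pos (hδ'.trans_le ((hlow 0).trans (hup 0)))
  have hn1 : (1 : ℝ) ≤ n := by exact_mod_cast hn
  have hinv : δ'⁻¹ < 1 := inv_lt_one_of_one_lt₀ hδ'
  have hinv0 : 0 < δ'⁻¹ := by positivity
  have h1inv : 0 < 1 - δ'⁻¹ := by linarith
  set N := 3 * (n : ℝ) + 2 * ε with hN
  set W := C * Real.log δ * (2 * (A * 2 ^ N)) with hW
  have hW0 : 0 < W := by positivity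
  refine ⟨W * (2 * (1 - δ'⁻¹)⁻¹), by positivity, fun M hM p => ?_⟩
  obtain ⟨j, x⟩ := p
  have hj : (0 : ℝ) < b j := (b j).2
  have hterm : ∀ i, ENNReal.ofReal (C * scaleWeight b i) *
      ∫⁻ z, levelKernel n b ε M (j, x) (i, z) ∂surfaceMeasure n ≤
      ENNReal.ofReal (M * W) * ENNReal.ofReal δ'⁻¹ ^ ((i : ℤ) - j).natAbs := by
    intro i
    have hi : (0 : ℝ) < b i := (b i).2
    have hP : 0 ≤ ((b j : ℝ) * b i) ^ ((n : ℝ) + ε) := by positivity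
    have hdecay : ((b j : ℝ) * b i) ^ ((n : ℝ) + ε) * ((b j : ℝ) + b i) ^ ((n : ℝ) - N) ≤
        δ'⁻¹ ^ ((i : ℤ) - j).natAbs := by
      have h1 : ((b j : ℝ) + b i) ^ ((n : ℝ) - N) =
          ((((b j : ℝ) + b i) ^ 2)⁻¹) ^ ((n : ℝ) + ε) := by
        rw [Real.inv_rpow (by positivity), ← Real.rpow_natCast, ← Real.rpow_mul (by positivity),
          ← Real.rpow_neg (by positivity)]
        congr 1
        rw [hN]
        push_cast
        ring
      rw [h1, ← Real.mul_rpow (by positivity) (by positivity), ← div_eq_mul_inv]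
      have hle := scale_mul_div_sq_add_le hδ' hlow i j
      have hle1 := hle.trans (pow_le_one₀ hinv0.le hinv.le)
      refine le_trans ?_ hle
      -- The base is at most `1` and the exponent `n + ε` at least `1`, so the exponent may be
      -- dropped.
      exact Real.rpow_le_self_of_le_one (by positivity) hle1 (by linarith)
    have hint : ∫⁻ z, levelKernel n b ε M (j, x) (i, z) ∂surfaceMeasure n ≤
        ENNReal.ofReal (M * ((2 * (A * 2 ^ N)) * δ'⁻¹ ^ ((i : ℤ) - j).natAbs)) := by
      calc ∫⁻ z, levelKernel n b ε M (j, x) (i, z) ∂surfaceMeasure n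
          = ∫⁻ z, ENNReal.ofReal (M * ((b j : ℝ) * b i) ^ ((n : ℝ) + ε)) *
              ENNReal.ofReal (((b j : ℝ) + b i + dist x z) ^ (-N)) ∂surfaceMeasure n := by
            refine lintegral_congr fun z => ?_
            rw [← ENNReal.ofReal_mul (by positivity), mul_assoc]
            rfl
        _ ≤ ENNReal.ofReal (M * ((b j : ℝ) * b i) ^ ((n : ℝ) + ε)) *
              ENNReal.ofReal (2 * (A * 2 ^ N) * ((b j : ℝ) + b i) ^ ((n : ℝ) - N)) := by
            rw [lintegral_const_mul' _ _ ENNReal.ofReal_ne_top]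
            gcongr
            exact lintegral_rpow_dist_le hA.le (hcap x) (by rw [hN]; linarith) (by positivity)
        _ ≤ _ := by
            rw [← ENNReal.ofReal_mul (by positivity)]
            refine ENNReal.ofReal_le_ofReal ?_
            calc M * ((b j : ℝ) * b i) ^ ((n : ℝ) + ε) *
                  (2 * (A * 2 ^ N) * ((b j : ℝ) + b i) ^ ((n : ℝ) - N))
                = M * ((2 * (A * 2 ^ N)) * (((b j : ℝ) * b i) ^ ((n : ℝ) + ε) *
                  ((b j : ℝ) + b i) ^ ((n : ℝ) - N))) := by ring
              _ ≤ _ := by gcongr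
    calc ENNReal.ofReal (C * scaleWeight b i) *
          ∫⁻ z, levelKernel n b ε M (j, x) (i, z) ∂surfaceMeasure n
        ≤ ENNReal.ofReal (C * Real.log δ) *
          ENNReal.ofReal (M * ((2 * (A * 2 ^ N)) * δ'⁻¹ ^ ((i : ℤ) - j).natAbs)) := by
          gcongr
          exact scaleWeight_le hup i
      _ = _ := by
          rw [← ENNReal.ofReal_pow hinv0.le, ← ENNReal.ofReal_mul (by positivity),
            ← ENNReal.ofReal_mul (by positivity)]
          congr 1
          rw [hW]
          ring
  rw [lintegral_levelMeasure]
  refine (ENNReal.tsum_le_tsum hterm).trans ?_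
  rw [ENNReal.tsum_mul_left]
  refine (mul_le_mul_right (tsum_pow_natAbs_sub_le _ j) _).trans_eq ?_
  rw [← mul_assoc M W, ENNReal.ofReal_mul (p := M * W) (by positivity), ENNReal.ofReal_mul zero_le_two,
    ENNReal.ofReal_inv_of_pos h1inv, ENNReal.ofReal_sub _ hinv0.le, ENNReal.ofReal_one,
    ENNReal.ofReal_ofNat]

/-! ### Sampling on a grid -/

/-- The bound is linear in `ρ`. Its factors are the Lipschitz constant of the kernel, the Schur
constant `L`, and the norm bound for the coefficients of `s`. -/
theorem lintegral_nearest_sub_le {n : ℕ} {κ : Param n → Param n → ℂ}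
    (hκ : IsReproducingKernel (paramMeasure n) κ) {b : ℕ → Scale} {δ δ' : ℝ} (hδ' : 1 < δ')
    (hlow : ∀ j, δ' ≤ (b j : ℝ) / b (j + 1)) {C Δ : ℝ} (hΔ0 : 0 ≤ Δ) (hΔ1 : Δ < 1)
    (hframe : IsFrameWith (kernelVector hκ) (semiDiscreteMeasure n b C) Δ)
    {d ω ε ε' : ℝ} (hd : 0 < d) (hω : 0 < ω) (hε : 0 < ε) (hε'0 : 0 < ε') (hε'1 : ε' < 1 / 2)
    (hloc : IsLocalized κ (b 0) d ω ε ε') {L : ℝ} (hL : 0 < L)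
    (hK : ∀ M : ℝ, 0 ≤ M → ∀ p : ℕ × Sphere n,
      ∫⁻ q, levelKernel n b ε M p q ∂levelMeasure n (fun j => C * scaleWeight b j) ≤
        ENNReal.ofReal (M * L))
    {ρ : ℝ} (hρ0 : 0 ≤ ρ) (hρ : ρ ≤ 1 / 4) (hρb : ρ * (b 0 : ℝ) ≤ 1 / 2)
    {Ξ : ℝ} (hΞ : Ξ ≤ ρ) (G : Grid n b δ Ξ) (s : kernelSpace hκ) :
    ∫⁻ p, ‖⟪kernelVector hκ (G.nearest p) - kernelVector hκ (b p.1, p.2), s⟫_ℂ‖ₑ ^ 2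
        ∂levelMeasure n (fun j => C * scaleWeight b j) ≤
      ENNReal.ofReal ((ρ * (2 * (2 ^ (3 * (n : ℝ) + 2 * ε) *
        (d * (1 + 2 * ω + 1 / ω) ^ (3 * (n : ℝ) + 2 * ε))) * L * (√(1 + Δ) / (1 - Δ))) *
          ‖s‖) ^ 2) := by
  have hcomplete := completeSpace_kernelSpace hκ
  set μ := levelMeasure n (fun j => C * scaleWeight b j) with hμ
  have hm : Measurable fun p : ℕ × Sphere n => ((b p.1, p.2) : Param n) :=
    (measurable_from_nat.comp measurable_fst).prodMk measurable_snd
  have hframe' : IsFrameWith (fun p : ℕ × Sphere n => kernelVector hκ (b p.1, p.2)) μ Δ := by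
    rw [← map_levelMeasure] at hframe
    exact hframe.comp_map hm
  obtain ⟨f, hf, hfn, hfs⟩ := hframe'.exists_coefficients hΔ0 hΔ1 s
  set M₀ := 2 * (2 ^ (3 * (n : ℝ) + 2 * ε) *
        (d * (1 + 2 * ω + 1 / ω) ^ (3 * (n : ℝ) + 2 * ε))) with hM₀
  have hM₀0 : 0 ≤ M₀ := by positivity
  have hpt : ∀ p : ℕ × Sphere n,
      ‖⟪kernelVector hκ (G.nearest p) - kernelVector hκ (b p.1, p.2), s⟫_ℂ‖ₑ ≤
        ∫⁻ q, levelKernel n b ε (ρ * M₀) p q * ‖f q‖ₑ ∂μ := by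
    intro p
    -- Expanding `s` in the scale-discrete frame leaves only kernel values at scales `b j ≤ b 0`,
    -- where localization applies.
    rw [hfs]
    refine (enorm_integral_le_lintegral_enorm _).trans (lintegral_mono fun q => ?_)
    rw [enorm_mul]
    gcongr
    rw [inner_sub_left, inner_kernelVector_kernelVector, inner_kernelVector_kernelVector,
      ← ofReal_norm]
    refine ENNReal.ofReal_le_ofReal ?_
    have hb0 : (0 : ℝ) < b p.1 := (b p.1).2
    refine hloc.norm_sub_le hd hω hε hε'0 hε'1 hρ (scale_le_scale_zero hδ' hlow _)
      (scale_le_scale_zero hδ' hlow _) ?_ ?_ q.2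
    · exact (mul_le_mul_of_nonneg_left (scale_le_scale_zero hδ' hlow _) hρ0).trans hρb
    · exact (G.dist_nearest_le p.1 p.2).trans (by gcongr)
  calc ∫⁻ p, ‖⟪kernelVector hκ (G.nearest p) - kernelVector hκ (b p.1, p.2), s⟫_ℂ‖ₑ ^ 2 ∂μ
      ≤ ∫⁻ p, (∫⁻ q, levelKernel n b ε (ρ * M₀) p q * ‖f q‖ₑ ∂μ) ^ 2 ∂μ := by
        gcongr with p
        exact hpt p
    _ ≤ ENNReal.ofReal (ρ * M₀ * L) ^ 2 * ∫⁻ q, ‖f q‖ₑ ^ 2 ∂μ :=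
        schur_test (measurable_levelKernel n b ε _) (levelKernel_comm n b ε _)
          (hK _ (by positivity)) hf.1.enorm
    _ ≤ ENNReal.ofReal (ρ * M₀ * L) ^ 2 *
        ENNReal.ofReal ((√(1 + Δ) / (1 - Δ) * ‖s‖) ^ 2) := by gcongr
    _ = _ := by
        rw [← ENNReal.ofReal_pow (by positivity), ← ENNReal.ofReal_mul (by positivity)]
        congr 1
        ring

theorem lintegral_levelMeasure_mono {n : ℕ} {w w' : ℕ → ℝ} (h : ∀ j, w j ≤ w' j)
    (F : ℕ × Sphere n → ℝ≥0∞) :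
    ∫⁻ p, F p ∂levelMeasure n w ≤ ∫⁻ p, F p ∂levelMeasure n w' := by
  rw [lintegral_levelMeasure, lintegral_levelMeasure]
  exact ENNReal.tsum_le_tsum fun j => by gcongr; exact h j

theorem lintegral_levelMeasure_const_mul {n : ℕ} {c : ℝ} (hc : 0 ≤ c) (w : ℕ → ℝ)
    (F : ℕ × Sphere n → ℝ≥0∞) :
    ∫⁻ p, F p ∂levelMeasure n (fun j => c * w j) =
      ENNReal.ofReal c * ∫⁻ p, F p ∂levelMeasure n w := by
  rw [lintegral_levelMeasure, lintegral_levelMeasure, ← ENNReal.tsum_mul_left]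
  simp only [ENNReal.ofReal_mul hc, mul_assoc]

/-- The frame property on a grid does not depend on the weights of the levels, as long as these
are comparable. -/
theorem Grid.isWeightedFrame_pointMeasure_const {n : ℕ} {b : ℕ → Scale} {δ Ξ : ℝ}
    (G : Grid n b δ Ξ) {E : Type*} [NormedAddCommGroup E] [InnerProductSpace ℂ E]
    {g : Param n → E} {w : ℕ → ℝ} {Δ : ℝ} (hΔ0 : 0 ≤ Δ) (hΔ : Δ < 1)
    (h : IsFrameWith g (G.pointMeasure w) Δ) {l u : ℝ} (hl : 0 < l) (hlw : ∀ j, l ≤ w j)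
    (hwu : ∀ j, w j ≤ u) : IsWeightedFrame g (G.pointMeasure fun _ => l / 2) := by
  have hu : 0 < u := hl.trans_le ((hlw 0).trans (hwu 0))
  have hlu : l ≤ u := (hlw 0).trans (hwu 0)
  have hratio : l / (2 * u) ≤ 1 / 2 := by
    rw [div_le_div_iff₀ (by positivity) two_pos]
    linarith
  have hratio0 : 0 < l / (2 * u) := by positivity
  -- From `l / (2u) * w j ≤ l / 2 ≤ w j / 2`. The halved weight puts the upper bound at `(1 + Δ) / 2
  -- < 1`, so only the lower bound determines the frame constant.
  refine ⟨1 - l / (2 * u) * (1 - Δ), by nlinarith, by nlinarith, fun v =>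
    ⟨G.aemeasurable_pointMeasure _ _, ?_, ?_⟩⟩
  · have h1 := (h v).2.1
    rw [G.lintegral_pointMeasure _ fun p => ‖⟪g p, v⟫_ℂ‖ₑ ^ 2] at h1 ⊢
    calc ENNReal.ofReal ((1 - (1 - l / (2 * u) * (1 - Δ))) * ‖v‖ ^ 2)
        = ENNReal.ofReal (l / (2 * u)) * ENNReal.ofReal ((1 - Δ) * ‖v‖ ^ 2) := by
          rw [← ENNReal.ofReal_mul hratio0.le]
          congr 1
          ring
      _ ≤ _ := by
          refine (mul_le_mul_right h1 _).trans ?_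
          rw [← lintegral_levelMeasure_const_mul hratio0.le]
          refine lintegral_levelMeasure_mono (fun j => ?_) _
          calc l / (2 * u) * w j ≤ l / (2 * u) * u := by gcongr; exact hwu j
            _ = l / 2 := by field_simp
  · have h1 := (h v).2.2
    rw [G.lintegral_pointMeasure _ fun p => ‖⟪g p, v⟫_ℂ‖ₑ ^ 2] at h1 ⊢
    calc _ ≤ ∫⁻ p, ‖⟪g (G.nearest p), v⟫_ℂ‖ₑ ^ 2 ∂levelMeasure n (fun j => 1 / 2 * w j) :=
          lintegral_levelMeasure_mono (fun j => by linarith [hlw j]) _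
      _ ≤ ENNReal.ofReal (1 / 2) * ENNReal.ofReal ((1 + Δ) * ‖v‖ ^ 2) := by
          rw [lintegral_levelMeasure_const_mul (by norm_num)]
          gcongr
      _ ≤ _ := by
          rw [← ENNReal.ofReal_mul (by norm_num), ← mul_assoc]
          refine ENNReal.ofReal_le_ofReal ?_
          gcongr
          nlinarith

end SphereFrames

theorem theorem4 (n : ℕ) (hn : 1 ≤ n)
    (κ : SphereFrames.Param n → SphereFrames.Param n → ℂ)
    (hκ : SphereFrames.IsReproducingKernel (SphereFrames.paramMeasure n) κ)
    (b : ℕ → SphereFrames.Scale) (δ : ℝ) (hb : SphereFrames.HasScaleRatios b δ)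
    (C : ℝ) (hC : 0 < C) (Δ : ℝ) (hΔ0 : 0 ≤ Δ) (hΔ1 : Δ < 1)
    (hframe : SphereFrames.IsFrameWith (SphereFrames.kernelVector hκ)
      (SphereFrames.semiDiscreteMeasure n b C) Δ)
    (d ω ε ε' : ℝ) (hd : 0 < d) (hω : 0 < ω) (hε : 0 < ε) (hε'0 : 0 < ε') (hε'1 : ε' < 1 / 2)
    (hloc : SphereFrames.IsLocalized κ (b 0) d ω ε ε') :
    ∃ ρ : ℝ, 0 < ρ ∧ ∃ C' : ℝ, 0 < C' ∧
      ∀ Ξ : ℝ, Ξ ≤ ρ → ∀ G : SphereFrames.Grid n b δ Ξ,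
        SphereFrames.IsWeightedFrame (SphereFrames.kernelVector hκ)
          (G.pointMeasure fun j => C * SphereFrames.scaleWeight b j) ∧
        SphereFrames.IsWeightedFrame (SphereFrames.kernelVector hκ)
          (G.pointMeasure fun _ => C') := by
  open SphereFrames in
  obtain ⟨δ', hδ', hb'⟩ := hb
  have hlow := fun j => (hb' j).1
  have hup := fun j => (hb' j).2
  obtain ⟨L, hL, hK⟩ := lintegral_levelKernel_le hn hδ' hlow hup hC hε
  set M := 2 * (2 ^ (3 * (n : ℝ) + 2 * ε) *
    (d * (1 + 2 * ω + 1 / ω) ^ (3 * (n : ℝ) + 2 * ε))) * L * (√(1 + Δ) / (1 - Δ)) with hM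
  have h1Δ : 0 < 1 - Δ := by linarith
  have hM0 : 0 < M := by positivity
  -- Any `Δ'` strictly between `Δ` and `1` leaves a positive margin `η` for the perturbation on both
  -- sides.
  obtain ⟨Δ', hΔΔ', hΔ'1⟩ := exists_between hΔ1
  have hη1 : 0 < √(1 - Δ) - √(1 - Δ') := sub_pos.2 (Real.sqrt_lt_sqrt (by linarith) (by linarith))
  have hη2 : 0 < √(1 + Δ') - √(1 + Δ) := sub_pos.2 (Real.sqrt_lt_sqrt (by linarith) (by linarith))
  have hb0 : (0 : ℝ) < b 0 := (b 0).2
  set η := min (√(1 - Δ) - √(1 - Δ')) (√(1 + Δ') - √(1 + Δ)) with hη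
  have hη0 : 0 < η := lt_min hη1 hη2
  -- The first two bounds serve the Lipschitz estimate: comparable decay near `x`, and chords of
  -- length at most `1 / 2` at every level. The third keeps the perturbation `ρ * M` within the
  -- margin.
  set ρ := min (1 / 4) (min (1 / (2 * (b 0 : ℝ))) (η / M)) with hρ
  have hρ0 : 0 < ρ := lt_min (by norm_num) (lt_min (by positivity) (by positivity))
  have hρ4 : ρ ≤ 1 / 4 := min_le_left _ _
  have hρb : ρ * (b 0 : ℝ) ≤ 1 / 2 := by
    have h : ρ ≤ 1 / (2 * (b 0 : ℝ)) := (min_le_right _ _).trans (min_le_left _ _)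
    calc ρ * (b 0 : ℝ) ≤ 1 / (2 * (b 0 : ℝ)) * b 0 := by gcongr
      _ = 1 / 2 := by field_simp
  have hρη : ρ * M ≤ η :=
    (le_div_iff₀ hM0).1 ((min_le_right _ _).trans (min_le_right _ _))
  have hη1' : η ≤ √(1 - Δ) - √(1 - Δ') := min_le_left _ _
  have hη2' : η ≤ √(1 + Δ') - √(1 + Δ) := min_le_right _ _
  have hlogδ' : 0 < Real.log δ' := Real.log_pos hδ'
  -- `C'` is half the lower bound `C * log δ'` of the level weights.
  refine ⟨ρ, hρ0, C * Real.log δ' / 2, by positivity, fun Ξ hΞ G => ?_⟩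
  have hm : Measurable fun p : ℕ × Sphere n => ((b p.1, p.2) : Param n) :=
    (measurable_from_nat.comp measurable_fst).prodMk measurable_snd
  have hlevel : IsFrameWith (fun p : ℕ × Sphere n => kernelVector hκ (b p.1, p.2))
      (levelMeasure n fun j => C * scaleWeight b j) Δ := by
    rw [← map_levelMeasure] at hframe
    exact hframe.comp_map hm
  have hgrid : IsFrameWith (kernelVector hκ)
      (G.pointMeasure fun j => C * scaleWeight b j) Δ' := by
    refine G.isFrameWith_pointMeasure (hlevel.perturb hΔ0 hΔ'1.le hΔΔ'.le (by positivity :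
      0 ≤ ρ * M) (by linarith) (by linarith)
      (fun u => (G.measurable_comp_nearest fun p => ⟪kernelVector hκ p, u⟫_ℂ).aemeasurable)
      fun u => ?_)
    exact lintegral_nearest_sub_le hκ hδ' hlow hΔ0 hΔ1 hframe hd hω hε hε'0 hε'1 hloc hL hK
      hρ0.le hρ4 hρb hΞ G u
  have hΔ'0 : 0 ≤ Δ' := hΔ0.trans hΔΔ'.le
  refine ⟨⟨Δ', hΔ'0, hΔ'1, hgrid⟩, ?_⟩
  exact G.isWeightedFrame_pointMeasure_const hΔ'0 hΔ'1 hgrid (by positivity)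
    (fun j => mul_le_mul_of_nonneg_left (le_scaleWeight hδ' hlow j) hC.le)
    (fun j => mul_le_mul_of_nonneg_left (scaleWeight_le hup j) hC.le)
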